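/- For $f:\{0,1\}^n\to\{0,1\}$ and $a\in\{0,1\}^n$ let $\hat f(a)=2^{-n}\sum_{x\in\{0,1\}^n}(-1)^{f(x)\oplus x\cdot a}$, and let $\hat f_{\max}^2=\max_a \hat f(a)^2$. A quantum query algorithm accesses $f$ only through the oracle $U_f:|x\rangle|b\rangle\mapsto|x\rangle|b\oplus f(x)\rangle$ (possibly adjoined to a finite workspace), interleaved with unitaries independent of $f$ and followed by a measurement in the computational basis; a classical algorithm is a randomised adaptive algorithm that queries values $f(x)$. The query complexity is the worst-case number of oracle calls. There are constants $C>0$ and $k\in\mathbb N$ such that for every $n\ge 0$, every accuracy $\epsilon\in(0,1]$ and every error bound $\delta\in(0,1)$ the following hold. 1. There is a quantum query algorithm making at most $$C\,\frac{1}{\epsilon^{3/2}}\,\Big(\log\frac{2}{\epsilon}\Big)^{k}\log\frac{2}{\delta}$$ queries (a bound independent of $n$), that is, $\tilde O(1/\epsilon^{3/2})$ queries, which for every $f:\{0,1\}^n\to\{0,1\}$ always outputs a closed interval of length at most $\epsilon$, and this interval contains $\hat f_{\max}^2$ with probability at least $1-\delta$. 2. There is a classical randomised query algorithm making at most $$C\,\frac{n}{\epsilon^{3}}\,\Big(\log\frac{2}{\epsilon}\cdot\log(n+2)\Big)^{k}\log\frac{2}{\delta}$$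 queries, that is, $\tilde O(n/\epsilon^3)$ queries, with the same guarantee. -/

import Mathlib

/-- The sign `(-1)^b` of a bit. -/
def bitSign (b : Bool) : ℝ := if b then -1 else 1

/-- The inner product `x · a = x₁a₁ ⊕ ⋯ ⊕ xₙaₙ` over the two-element field. -/
def bitDot {n : ℕ} (x a : Fin n → Bool) : Bool :=
  decide (Odd (Finset.univ.filter fun i => x i = true ∧ a i = true).card)

/-- The Walsh (Fourier) coefficient `2⁻ⁿ ∑ₓ (-1)^(f(x) ⊕ x·a)` of an `n`-bit Boolean function. -/
noncomputable def walshCoeff {n : ℕ} (f : (Fin n → Bool) → Bool) (a : Fin n → Bool) : ℝ :=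
  (1 / 2 ^ n) * ∑ x : Fin n → Bool, bitSign (xor (f x) (bitDot x a))

/-- `max_a f̂(a)²`, the square of the largest absolute value of a Walsh coefficient. -/
noncomputable def walshMaxSq {n : ℕ} (f : (Fin n → Bool) → Bool) : ℝ :=
  Finset.univ.sup' Finset.univ_nonempty fun a : Fin n → Bool => walshCoeff f a ^ 2

/-- Deterministic adaptive query algorithms (decision trees) on `n`-bit Boolean functions, with
outputs in `O`: either stop with an output, or query the function at a point and continue
depending on the answer. -/
inductive DecisionTree (n : ℕ) (O : Type) : Type
  | output (o : O) : DecisionTree n O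
  | query (x : Fin n → Bool) (next : Bool → DecisionTree n O) : DecisionTree n O

namespace DecisionTree

/-- The output of the algorithm when its queries are answered by `f`. -/
def run {n : ℕ} {O : Type} (f : (Fin n → Bool) → Bool) : DecisionTree n O → O
  | output o => o
  | query x next => (next (f x)).run f

/-- The largest number of queries along any path. -/
def depth {n : ℕ} {O : Type} : DecisionTree n O → ℕ
  | output _ => 0
  | query _ next => max (next false).depth (next true).depth + 1

end DecisionTree

/-- A classical randomised query algorithm: a probability distribution on decision trees (the
internal randomness selects a deterministic query algorithm), all making at most `queries`
queries. -/
structure RandomizedQueryAlgorithm (n : ℕ) (O : Type) where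
  /-- The distribution from which the decision tree is drawn. -/
  tree : PMF (DecisionTree n O)
  /-- The worst-case number of queries. -/
  queries : ℕ
  depth_le : ∀ t ∈ tree.support, t.depth ≤ queries

namespace RandomizedQueryAlgorithm

/-- The distribution of the output when the queries are answered by `f`. -/
noncomputable def outputDist {n : ℕ} {O : Type} (A : RandomizedQueryAlgorithm n O)
    (f : (Fin n → Bool) → Bool) : PMF O :=
  A.tree.map (DecisionTree.run f)

/-- The probability that the output lies in `S` when the queries are answered by `f`. -/
noncomputable def prob {n : ℕ} {O : Type} (A : RandomizedQueryAlgorithm n O)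
    (f : (Fin n → Bool) → Bool) (S : Set O) : ℝ :=
  ((A.outputDist f).toOuterMeasure S).toReal

end RandomizedQueryAlgorithm

/-- Labels of the computational basis: an `n`-qubit query register, a one-qubit answer register and
a workspace register whose basis is labelled by `W`. -/
abbrev QueryBasis (n : ℕ) (W : Type) : Type := (Fin n → Bool) × Bool × W

/-- The oracle `U_f`, i.e. the unitary `|x, b, w⟩ ↦ |x, b ⊕ f(x), w⟩`, acting on vectors of
amplitudes. -/
def applyOracle {n : ℕ} {W : Type} (f : (Fin n → Bool) → Bool) (ψ : QueryBasis n W → ℂ) :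
    QueryBasis n W → ℂ :=
  fun i => ψ (i.1, xor i.2.1 (f i.1), i.2.2)

theorem applyOracle_single {n : ℕ} {W : Type} [DecidableEq W] (f : (Fin n → Bool) → Bool)
    (x : Fin n → Bool) (b : Bool) (w : W) :
    applyOracle f (Pi.single (x, b, w) (1 : ℂ)) = Pi.single (x, xor b (f x), w) (1 : ℂ) := by
  funext ⟨y, c, v⟩
  by_cases hxy : y = x
  · subst hxy
    by_cases hv : v = w
    · subst hv
      cases b <;> cases c <;> cases h : f y <;> simp [applyOracle, h]
    · simp [applyOracle, hv]
  · simp [applyOracle, hxy]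

/-- A quantum query algorithm with outputs in `O`. It starts in a basis state, alternates
unitaries that do not depend on the queried function with oracle calls, in the order
`V_T U_f V_{T-1} ⋯ U_f V_0` where `T` is `queries`, then measures all registers in the
computational basis and post-processes the outcome. -/
structure QuantumQueryAlgorithm (n : ℕ) (O : Type) where
  /-- Labels of the basis of the workspace. -/
  W : Type
  [fintypeW : Fintype W]
  [decEqW : DecidableEq W]
  /-- The initial basis state. -/
  init : QueryBasis n W
  /-- The number of oracle calls. -/
  queries : ℕ
  /-- `V t` is applied after the `t`-th oracle call; only `V 0, …, V queries` are used. -/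
  V : ℕ → Matrix.unitaryGroup (QueryBasis n W) ℂ
  /-- The output announced for each measurement outcome. -/
  out : QueryBasis n W → O

namespace QuantumQueryAlgorithm

attribute [instance] fintypeW decEqW

/-- The amplitudes after `t` oracle calls, with `V t` applied. -/
noncomputable def state {n : ℕ} {O : Type} (A : QuantumQueryAlgorithm n O)
    (f : (Fin n → Bool) → Bool) : ℕ → QueryBasis n A.W → ℂ
  | 0 => (A.V 0 : Matrix (QueryBasis n A.W) (QueryBasis n A.W) ℂ).mulVec (Pi.single A.init 1)
  | t + 1 => (A.V (t + 1) : Matrix (QueryBasis n A.W) (QueryBasis n A.W) ℂ).mulVec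
      (applyOracle f (A.state f t))

open Classical in
/-- The probability that the output lies in `S` when the oracle is that of `f`. -/
noncomputable def prob {n : ℕ} {O : Type} (A : QuantumQueryAlgorithm n O)
    (f : (Fin n → Bool) → Bool) (S : Set O) : ℝ :=
  ∑ i : QueryBasis n A.W, if A.out i ∈ S then ‖A.state f A.queries i‖ ^ 2 else 0

end QuantumQueryAlgorithm

/-! Classical half: each Walsh coefficient is the mean of a sign over uniform `x`, so one set of
uniform samples estimates all of them at once. A Chernoff bound and a union over the `2 ^ n`
coefficients show that order `(n + log (1/δ)) / ε ^ 2` samples suffice, which is already below the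
claimed bound.

Quantum half: one query samples `a` with probability `f̂(a)²`. For a fixed `a`, amplitude estimation
of this probability distinguishes `f̂(a)² ≤ τ` from `f̂(a)² ≥ τ + g` in `O(1/g)` queries, and a
majority vote makes the answer reliable. Run this test on a sampled `a`. If some `f̂(a)² ≥ τ + g`,
acceptance has probability at least `g/2`, because that `a` is itself sampled with probability at
least `g`; if all are at most `τ`, it has probability at most `g/8`. A second amplitude estimation
separates the two cases with `O(1/√g)` uses of the test, so the cost is `g^(-3/2)` up to logarithms,
independently of `n`. Binary search over `τ` with `g = ε/2` then locates the maximum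
(`exists_walshMaxSq_test`, `exists_binary_search`).

The nesting works because a sampled algorithm is kept as one unitary whose measurement is deferred
(`QuerySamplable.bind`), so it can be inverted and amplified. Amplitude estimation rests on a
three-term recurrence: on the start vector the Grover iterate satisfies `G + G⁻¹ = 2(1 - 2p)`. With
a sine window on the counter and a measurement in the eigenbasis of the path graph, the second
moment of the error is bounded directly, and Chebyshev's inequality finishes
(`sum_normSq_three_term_le`, `QuerySamplable.exists_amplitude_estimation`). -/

/-! ### Classical estimation by uniform sampling -/

/-- The tree that queries the points `ω 0, …, ω (m - 1)` and outputs a function of the answers. -/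
def DecisionTree.queryAll {n : ℕ} {O : Type} :
    (m : ℕ) → (Fin m → Fin n → Bool) → ((Fin m → Bool) → O) → DecisionTree n O
  | 0, _, g => .output (g Fin.elim0)
  | m + 1, ω, g => .query (ω 0) fun b => queryAll m (Fin.tail ω) fun v => g (Fin.cons b v)

theorem DecisionTree.run_queryAll {n : ℕ} {O : Type} (f : (Fin n → Bool) → Bool) (m : ℕ)
    (ω : Fin m → Fin n → Bool) (g : (Fin m → Bool) → O) :
    (queryAll m ω g).run f = g fun i => f (ω i) := by
  induction m with
  | zero => exact congrArg g (Subsingleton.elim _ _)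
  | succ m ih =>
    simp only [queryAll, run, ih]
    congr 1
    funext i
    refine Fin.cases ?_ (fun j => ?_) i <;> simp [Fin.tail]

theorem DecisionTree.depth_queryAll {n : ℕ} {O : Type} (m : ℕ)
    (ω : Fin m → Fin n → Bool) (g : (Fin m → Bool) → O) :
    (queryAll m ω g).depth = m := by
  induction m with
  | zero => rfl
  | succ m ih => simp [queryAll, depth, ih]

theorem abs_bitSign (b : Bool) : |bitSign b| = 1 := by
  cases b <;> simp [bitSign]

/-- A Chernoff bound for sums of independent uniform samples of a centred function. -/
theorem card_large_sum_le {X : Type*} [Fintype X] (Y : X → ℝ) (hY : ∀ x, |Y x| ≤ 2)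
    (hsum : ∑ x, Y x = 0) (m : ℕ) {t : ℝ} (ht : 0 < t) (ht1 : t ≤ 1) :
    (Fintype.card {ω : Fin m → X // m * t ≤ ∑ i, Y (ω i)} : ℝ) ≤
      (Fintype.card X : ℝ) ^ m * Real.exp (-(m * t ^ 2 / 16)) := by
  classical
  -- The parameter `t / 8` keeps the exponent `u` in `[-1, 1]`, where `exp u ≤ 1 + u + u²`. Per
  -- sample, the moment `exp (t² / 16)` against the Markov factor `exp (-t² / 8)` leaves `exp (-t² /
  -- 16)`.
  have key : ∑ x, Real.exp (t / 8 * Y x) ≤ Fintype.card X * Real.exp (t ^ 2 / 16) := by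
    have h1 : ∀ x, Real.exp (t / 8 * Y x) ≤ 1 + t / 8 * Y x + t ^ 2 / 16 := by
      intro x
      have hb : |t / 8 * Y x| ≤ t / 4 := by
        rw [abs_mul, abs_of_pos (by positivity)]
        nlinarith [hY x]
      have h2 := (abs_le.1 (Real.abs_exp_sub_one_sub_id_le (hb.trans (by linarith)))).2
      have h3 : (t / 8 * Y x) ^ 2 ≤ (t / 4) ^ 2 := sq_le_sq' (abs_le.1 hb).1 (abs_le.1 hb).2
      nlinarith
    calc ∑ x, Real.exp (t / 8 * Y x) ≤ ∑ x, (1 + t / 8 * Y x + t ^ 2 / 16) :=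
          Finset.sum_le_sum fun x _ => h1 x
      _ = Fintype.card X * (1 + t ^ 2 / 16) := by
          rw [Finset.sum_add_distrib, Finset.sum_add_distrib, ← Finset.mul_sum, hsum]
          simp; ring
      _ ≤ _ := by
          gcongr
          linarith [Real.add_one_le_exp (t ^ 2 / 16)]
  rw [Fintype.card_subtype, Finset.cast_card]
  calc ∑ ω : Fin m → X with m * t ≤ ∑ i, Y (ω i), (1 : ℝ)
      ≤ ∑ ω : Fin m → X with m * t ≤ ∑ i, Y (ω i),
          Real.exp (t / 8 * (∑ i, Y (ω i) - m * t)) := by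
        refine Finset.sum_le_sum fun ω hω => Real.one_le_exp ?_
        have := (Finset.mem_filter.1 hω).2
        exact mul_nonneg (by positivity) (by linarith)
    _ ≤ ∑ ω : Fin m → X, Real.exp (t / 8 * (∑ i, Y (ω i) - m * t)) :=
        Finset.sum_le_sum_of_subset_of_nonneg (Finset.filter_subset _ _)
          fun _ _ _ => (Real.exp_pos _).le
    _ = (∑ x, Real.exp (t / 8 * Y x)) ^ m * Real.exp (-(m * t ^ 2 / 8)) := by
        rw [← Fin.prod_const, Fintype.prod_sum, Finset.sum_mul]
        refine Finset.sum_congr rfl fun ω _ => ?_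
        rw [← Real.exp_sum, ← Real.exp_add, ← Finset.mul_sum]
        ring_nf
    _ ≤ (Fintype.card X * Real.exp (t ^ 2 / 16)) ^ m * Real.exp (-(m * t ^ 2 / 8)) := by
        gcongr
    _ = _ := by
        rw [mul_pow, ← Real.exp_nat_mul, mul_assoc, ← Real.exp_add]
        ring_nf

/-- The estimate of a Walsh coefficient from sampled points and the values of the function. -/
noncomputable def sampleWalsh {n m : ℕ} (ω : Fin m → Fin n → Bool) (v : Fin m → Bool)
    (a : Fin n → Bool) : ℝ :=
  (1 / m) * ∑ i, bitSign (xor (v i) (bitDot (ω i) a))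

/-- The estimate of the maximal squared Walsh coefficient from sampled values. -/
noncomputable def sampleWalshMaxSq {n m : ℕ} (ω : Fin m → Fin n → Bool) (v : Fin m → Bool) : ℝ :=
  Finset.univ.sup' Finset.univ_nonempty fun a : Fin n → Bool => sampleWalsh ω v a ^ 2

theorem abs_walshCoeff_le_one {n : ℕ} (f : (Fin n → Bool) → Bool) (a : Fin n → Bool) :
    |walshCoeff f a| ≤ 1 := by
  unfold walshCoeff
  rw [abs_mul, abs_of_pos (by positivity), one_div, inv_mul_le_iff₀ (by positivity), mul_one]
  refine (Finset.abs_sum_le_sum_abs _ _).trans ?_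
  simp [abs_bitSign]

theorem abs_sampleWalsh_le_one {n m : ℕ} (ω : Fin m → Fin n → Bool) (v : Fin m → Bool)
    (a : Fin n → Bool) : |sampleWalsh ω v a| ≤ 1 := by
  unfold sampleWalsh
  rcases Nat.eq_zero_or_pos m with rfl | hm
  · simp
  have : (0 : ℝ) < m := by exact_mod_cast hm
  rw [abs_mul, abs_of_pos (by positivity), one_div, inv_mul_le_iff₀ (by positivity), mul_one]
  refine (Finset.abs_sum_le_sum_abs _ _).trans ?_
  simp [abs_bitSign]

theorem abs_sup'_sub_sup'_le {A : Type*} [Fintype A] [Nonempty A] (u v : A → ℝ) {r : ℝ}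
    (h : ∀ a, |u a - v a| ≤ r) :
    |Finset.univ.sup' Finset.univ_nonempty u - Finset.univ.sup' Finset.univ_nonempty v| ≤ r := by
  rw [abs_sub_le_iff]
  constructor
  · rw [sub_le_iff_le_add]
    refine Finset.sup'_le _ _ fun a ha => ?_
    have := Finset.le_sup' v ha
    linarith [(abs_le.1 (h a)).2]
  · rw [sub_le_iff_le_add]
    refine Finset.sup'_le _ _ fun a ha => ?_
    have := Finset.le_sup' u ha
    linarith [(abs_le.1 (h a)).1]

theorem abs_sampleWalshMaxSq_sub_le {n m : ℕ} (f : (Fin n → Bool) → Bool)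
    (ω : Fin m → Fin n → Bool) {t : ℝ}
    (h : ∀ a, |sampleWalsh ω (fun i => f (ω i)) a - walshCoeff f a| ≤ t) :
    |sampleWalshMaxSq ω (fun i => f (ω i)) - walshMaxSq f| ≤ 2 * t := by
  refine abs_sup'_sub_sup'_le _ _ fun a => ?_
  rw [sq_sub_sq, abs_mul]
  have h1 := abs_sampleWalsh_le_one ω (fun i => f (ω i)) a
  have h2 := abs_walshCoeff_le_one f a
  have h3 := abs_add_le (sampleWalsh ω (fun i => f (ω i)) a) (walshCoeff f a)
  exact mul_le_mul (by linarith) (h a) (abs_nonneg _) (by norm_num)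

/-- Union bound over the `2 ^ n` coefficients and the two directions of deviation, whence the factor
`2 ^ n * 2`. -/
theorem card_bad_samples_le {n m : ℕ} (hm : 0 < m) (f : (Fin n → Bool) → Bool) {t : ℝ}
    (ht : 0 < t) (ht1 : t ≤ 1) :
    (Fintype.card {ω : Fin m → Fin n → Bool //
        ∃ a, t < |sampleWalsh ω (fun i => f (ω i)) a - walshCoeff f a|} : ℝ) ≤
      2 ^ n * 2 * Real.exp (-(m * t ^ 2 / 16)) * Fintype.card (Fin m → Fin n → Bool) := by
  classical
  have hm' : (0 : ℝ) < m := by exact_mod_cast hm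
  -- The sign `c` turns the lower tail into an upper tail, so that the one-sided Chernoff bound
  -- covers both.
  let Y : Bool → (Fin n → Bool) → (Fin n → Bool) → ℝ := fun c a x =>
    bitSign c * (bitSign (xor (f x) (bitDot x a)) - walshCoeff f a)
  have hY : ∀ c a x, |Y c a x| ≤ 2 := by
    intro c a x
    simp only [Y, abs_mul, abs_bitSign, one_mul]
    refine (abs_sub _ _).trans ?_
    rw [abs_bitSign]
    linarith [abs_walshCoeff_le_one f a]
  have hsum : ∀ c a, ∑ x, Y c a x = 0 := by
    intro c a
    simp only [Y]
    rw [← Finset.mul_sum, Finset.sum_sub_distrib]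
    simp [walshCoeff]
  have hest : ∀ c a (ω : Fin m → Fin n → Bool), ∑ i, Y c a (ω i) =
      bitSign c * (m * (sampleWalsh ω (fun i => f (ω i)) a - walshCoeff f a)) := by
    intro c a ω
    simp only [Y, sampleWalsh]
    rw [← Finset.mul_sum, Finset.sum_sub_distrib]
    simp
    field_simp
    simp
  rw [Fintype.card_subtype]
  calc ((Finset.univ.filter fun ω : Fin m → Fin n → Bool =>
        ∃ a, t < |sampleWalsh ω (fun i => f (ω i)) a - walshCoeff f a|).card : ℝ)
      ≤ ((Finset.univ : Finset ((Fin n → Bool) × Bool)).biUnion fun p =>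
          Finset.univ.filter fun ω : Fin m → Fin n → Bool =>
            m * t ≤ ∑ i, Y p.2 p.1 (ω i)).card := by
        norm_cast
        refine Finset.card_le_card fun ω hω => ?_
        obtain ⟨a, ha⟩ := (Finset.mem_filter.1 hω).2
        simp only [Finset.mem_biUnion, Finset.mem_univ, Finset.mem_filter, true_and, Prod.exists]
        rcases lt_abs.1 ha with h | h
        · refine ⟨a, false, ?_⟩
          rw [hest]
          simp only [bitSign, Bool.false_eq_true, if_false, one_mul]
          gcongr
        · refine ⟨a, true, ?_⟩
          rw [hest]
          simp only [bitSign, if_true]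
          nlinarith
    _ ≤ ∑ p : (Fin n → Bool) × Bool, ((Finset.univ.filter fun ω : Fin m → Fin n → Bool =>
            m * t ≤ ∑ i, Y p.2 p.1 (ω i)).card : ℝ) := by
        exact_mod_cast Finset.card_biUnion_le
    _ ≤ ∑ p : (Fin n → Bool) × Bool,
          (Fintype.card (Fin n → Bool) : ℝ) ^ m * Real.exp (-(m * t ^ 2 / 16)) := by
        refine Finset.sum_le_sum fun p _ => ?_
        have := card_large_sum_le (Y p.2 p.1) (hY _ _) (hsum _ _) m ht ht1
        rwa [Fintype.card_subtype] at this
    _ = _ := by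
        simp
        ring

/-- The closed interval of centre `c` and radius `r`. -/
def intervalAround (c r : ℝ) (hr : 0 ≤ r) : NonemptyInterval ℝ :=
  ⟨(c - r, c + r), by linarith⟩

theorem length_intervalAround (c r : ℝ) (hr : 0 ≤ r) : (intervalAround c r hr).length = 2 * r := by
  simp only [intervalAround, NonemptyInterval.length]; ring

theorem mem_intervalAround {c r : ℝ} {hr : 0 ≤ r} {x : ℝ} (h : |c - x| ≤ r) :
    x ∈ intervalAround c r hr := by
  rw [NonemptyInterval.mem_mk]
  rw [abs_sub_le_iff] at h
  exact ⟨by simp only [intervalAround]; linarith, by simp only [intervalAround]; linarith⟩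

/-- The nonadaptive algorithm that estimates the maximal squared Walsh coefficient from `m`
uniform samples. -/
noncomputable def samplingAlgorithm (n m : ℕ) (ε : ℝ) (hε : 0 ≤ ε / 2) :
    RandomizedQueryAlgorithm n (NonemptyInterval ℝ) where
  tree := (PMF.uniformOfFintype (Fin m → Fin n → Bool)).map fun ω =>
    DecisionTree.queryAll m ω fun v => intervalAround (sampleWalshMaxSq ω v) (ε / 2) hε
  queries := m
  depth_le t ht := by
    obtain ⟨ω, -, rfl⟩ := (PMF.mem_support_map_iff _ _ _).1 ht
    exact (DecisionTree.depth_queryAll _ _ _).le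

theorem one_sub_le_prob_samplingAlgorithm {n m : ℕ} (hm : 0 < m) {ε δ : ℝ} (hε : 0 < ε)
    (hε1 : ε ≤ 1) (hδ : 2 ^ n * 2 * Real.exp (-(m * (ε / 4) ^ 2 / 16)) ≤ δ)
    (f : (Fin n → Bool) → Bool) :
    1 - δ ≤ (samplingAlgorithm n m ε (by positivity)).prob f {J | walshMaxSq f ∈ J} := by
  classical
  unfold RandomizedQueryAlgorithm.prob RandomizedQueryAlgorithm.outputDist samplingAlgorithm
  simp only [PMF.map_comp, PMF.toOuterMeasure_map_apply, PMF.toOuterMeasure_uniformOfFintype_apply]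
  set good : Set (Fin m → Fin n → Bool) := (DecisionTree.run f ∘ fun ω =>
    DecisionTree.queryAll m ω fun v => intervalAround (sampleWalshMaxSq ω v) (ε / 2)
      (by positivity)) ⁻¹' {J : NonemptyInterval ℝ | walshMaxSq f ∈ J}
  have hgood : ∀ ω : Fin m → Fin n → Bool, ω ∉ good →
      ∃ a, ε / 4 < |sampleWalsh ω (fun i => f (ω i)) a - walshCoeff f a| := by
    intro ω hω
    by_contra! hcon
    refine hω ?_
    show walshMaxSq f ∈ DecisionTree.run f (DecisionTree.queryAll m ω fun v =>
      intervalAround (sampleWalshMaxSq ω v) (ε / 2) (by positivity))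
    rw [DecisionTree.run_queryAll]
    refine mem_intervalAround ?_
    have := abs_sampleWalshMaxSq_sub_le f ω hcon
    linarith
  have hbad := card_bad_samples_le hm f (t := ε / 4) (by positivity) (by linarith)
  have hcompl : Fintype.card (Fin m → Fin n → Bool) ≤ Fintype.card good +
      Fintype.card {ω : Fin m → Fin n → Bool //
        ∃ a, ε / 4 < |sampleWalsh ω (fun i => f (ω i)) a - walshCoeff f a|} := by
    have h1 : Fintype.card (goodᶜ : Set (Fin m → Fin n → Bool)) ≤
        Fintype.card {ω : Fin m → Fin n → Bool //
          ∃ a, ε / 4 < |sampleWalsh ω (fun i => f (ω i)) a - walshCoeff f a|} :=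
      Fintype.card_le_of_injective (fun ω => ⟨ω.1, hgood ω.1 ω.2⟩) fun ω₁ ω₂ h => by
        simpa [Subtype.ext_iff] using h
    have h2 := Fintype.card_compl_set good
    have h3 := set_fintype_card_le_univ good
    omega
  have hpos : (0 : ℝ) < Fintype.card (Fin m → Fin n → Bool) := by
    exact_mod_cast Fintype.card_pos
  rw [ENNReal.toReal_div, ENNReal.toReal_natCast, ENNReal.toReal_natCast, le_div_iff₀ hpos]
  have hcompl' : (Fintype.card (Fin m → Fin n → Bool) : ℝ) ≤ Fintype.card good +
      Fintype.card {ω : Fin m → Fin n → Bool //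
        ∃ a, ε / 4 < |sampleWalsh ω (fun i => f (ω i)) a - walshCoeff f a|} := by
    exact_mod_cast hcompl
  have := mul_le_mul_of_nonneg_right hδ hpos.le
  linarith

theorem exists_classical_algorithm :
    ∃ (C : ℝ) (k : ℕ), ∀ (n : ℕ) (ε δ : ℝ), 0 < ε → ε ≤ 1 → 0 < δ → δ < 1 →
      ∃ A : RandomizedQueryAlgorithm n (NonemptyInterval ℝ),
        (A.queries : ℝ) ≤
          C * (n / ε ^ 3) * (Real.log (2 / ε) * Real.log (n + 2)) ^ k * Real.log (2 / δ) ∧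
        (∀ t ∈ A.tree.support, ∀ f : (Fin n → Bool) → Bool, (t.run f).length ≤ ε) ∧
        ∀ f : (Fin n → Bool) → Bool, 1 - δ ≤ A.prob f {J | walshMaxSq f ∈ J} := by
  -- No power of the logarithms is needed. The constant is `256 * 2 * 2`: one factor 2 pays for the
  -- ceiling, the other for merging `n log 2 + log (2/δ)` into a product.
  refine ⟨1024, 0, fun n ε δ hε hε1 hδ hδ1 => ?_⟩
  -- For `n = 0` no query is allowed, but the only coefficient is `±1`, so the constant answer 1 is
  -- exact.
  rcases Nat.eq_zero_or_pos n with rfl | hn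
  · refine ⟨⟨PMF.pure (.output (intervalAround 1 0 le_rfl)), 0, ?_⟩, by simp, ?_, ?_⟩
    · intro t ht
      rw [PMF.mem_support_pure_iff] at ht
      subst ht
      simp [DecisionTree.depth]
    · intro t ht f
      rw [PMF.mem_support_pure_iff] at ht
      subst ht
      rw [DecisionTree.run, length_intervalAround]
      linarith
    · intro f
      have h1 : walshMaxSq f = 1 := by
        have : ∀ a, walshCoeff f a ^ 2 = 1 := by
          intro a
          rw [walshCoeff, Fintype.sum_unique]
          have h : ∀ b, (1 / 2 ^ 0 * bitSign b) ^ 2 = 1 := by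
            intro b
            cases b <;> norm_num [bitSign]
          exact h _
        simp [walshMaxSq, this]
      have h2 : walshMaxSq f ∈ intervalAround 1 0 le_rfl := mem_intervalAround (by simp [h1])
      simp only [RandomizedQueryAlgorithm.prob, RandomizedQueryAlgorithm.outputDist, PMF.pure_map,
        DecisionTree.run, PMF.toOuterMeasure_pure_apply, Set.mem_ofPred_eq, h2, if_true,
        ENNReal.toReal_one]
      linarith
  have hn1 : (1 : ℝ) ≤ n := by exact_mod_cast hn
  have hlogδ : 0 ≤ Real.log (2 / δ) - Real.log 2 := by
    rw [Real.log_div two_ne_zero hδ.ne']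
    linarith [Real.log_neg hδ hδ1]
  have hlog2 := Real.log_two_gt_d9
  have hlog2' := Real.log_two_lt_d9
  -- Here `256 = 16 * 4 ^ 2` is chosen so that the failure bound at accuracy `ε / 4` is exactly `δ`
  -- for `m = r`.
  set r : ℝ := 256 / ε ^ 2 * (n * Real.log 2 + Real.log (2 / δ)) with hr
  have hr1 : 1 ≤ r := by
    have : 1 ≤ 1 / ε ^ 2 := by
      rw [le_div_iff₀ (by positivity)]
      nlinarith
    have h256 : 256 ≤ 256 / ε ^ 2 := by
      rw [div_eq_mul_one_div]
      linarith
    have h1 : 1 ≤ n * Real.log 2 + Real.log (2 / δ) := by nlinarith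
    calc (1 : ℝ) ≤ 256 * 1 := by norm_num
      _ ≤ r := mul_le_mul h256 h1 zero_le_one (by positivity)
  have hm : 0 < ⌈r⌉₊ := Nat.ceil_pos.2 (by linarith)
  refine ⟨samplingAlgorithm n ⌈r⌉₊ ε (by positivity), ?_, ?_, ?_⟩
  · simp only [samplingAlgorithm, pow_zero, mul_one]
    have h1 : (⌈r⌉₊ : ℝ) ≤ 2 * r := by linarith [Nat.ceil_lt_add_one (by linarith : 0 ≤ r)]
    refine h1.trans ?_
    have h2 : n * Real.log 2 + Real.log (2 / δ) ≤ 2 * n * Real.log (2 / δ) := by nlinarith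
    have h3 : 256 / ε ^ 2 ≤ 256 / ε ^ 3 := by
      refine div_le_div_of_nonneg_left (by norm_num) (by positivity) ?_
      nlinarith [sq_nonneg ε]
    calc 2 * r ≤ 2 * (256 / ε ^ 3 * (2 * n * Real.log (2 / δ))) := by
          rw [hr]
          gcongr
          nlinarith
      _ = _ := by ring
  · intro t ht f
    obtain ⟨ω, -, rfl⟩ := (PMF.mem_support_map_iff _ _ _).1 ht
    rw [DecisionTree.run_queryAll, length_intervalAround]
    linarith
  · refine one_sub_le_prob_samplingAlgorithm hm hε hε1 ?_
    have h1 : n * Real.log 2 + Real.log (2 / δ) ≤ ⌈r⌉₊ * (ε / 4) ^ 2 / 16 := by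
      have := Nat.le_ceil r
      calc n * Real.log 2 + Real.log (2 / δ) = r * (ε / 4) ^ 2 / 16 := by
            rw [hr]; field_simp; ring
        _ ≤ _ := by gcongr
    calc (2 : ℝ) ^ n * 2 * Real.exp (-(⌈r⌉₊ * (ε / 4) ^ 2 / 16))
        ≤ 2 ^ n * 2 * Real.exp (-(n * Real.log 2 + Real.log (2 / δ))) := by gcongr
      _ = δ := by
          rw [neg_add, Real.exp_add, Real.exp_neg, Real.exp_neg, Real.exp_nat_mul,
            Real.exp_log two_pos, Real.exp_log (by positivity)]
          field_simp

/-! ### Unitary matrices: prescribed columns, blocks and controls -/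

open Matrix in
theorem sum_normSq_col {ι : Type*} [Fintype ι] [DecidableEq ι] (U : unitaryGroup ι ℂ) (j : ι) :
    ∑ i, ‖(U : Matrix ι ι ℂ) i j‖ ^ 2 = 1 := by
  have h := congrFun (congrFun (Unitary.coe_star_mul_self U) j) j
  rw [Matrix.mul_apply, Matrix.one_apply_eq] at h
  have h2 : ((∑ i, ‖(U : Matrix ι ι ℂ) i j‖ ^ 2 : ℝ) : ℂ) = 1 := by
    rw [← h]
    push_cast
    refine Finset.sum_congr rfl fun i _ => ?_
    rw [Matrix.star_apply, ← Complex.conj_mul']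
    rfl
  exact_mod_cast h2

open Matrix in
/-- Every unit vector is the first column of a unitary matrix. -/
theorem exists_unitary_col {ι : Type*} [Fintype ι] [DecidableEq ι] (j : ι) (v : ι → ℂ)
    (hv : ∑ i, ‖v i‖ ^ 2 = 1) : ∃ U : unitaryGroup ι ℂ, ∀ i, (U : Matrix ι ι ℂ) i j = v i := by
  let w : EuclideanSpace ℂ ι := WithLp.toLp 2 v
  have hw : ‖w‖ = 1 := by
    rw [EuclideanSpace.norm_eq, Real.sqrt_eq_one]
    exact hv
  obtain ⟨b, hb⟩ := Orthonormal.exists_orthonormalBasis_extension_of_card_eq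
    (𝕜 := ℂ) (E := EuclideanSpace ℂ ι) (ι := ι) (by simp) (v := fun _ => w) (s := {j})
    ⟨fun i => hw, fun i k hik => (hik (Subsingleton.elim _ _)).elim⟩
  refine ⟨⟨(EuclideanSpace.basisFun ι ℂ).toBasis.toMatrix b.toBasis,
    (EuclideanSpace.basisFun ι ℂ).toMatrix_orthonormalBasis_mem_unitary b⟩, fun i => ?_⟩
  simp [Module.Basis.toMatrix_apply, hb j rfl, w]

namespace Matrix.unitaryGroup

variable {ι ι' : Type*} [Fintype ι] [DecidableEq ι] [Fintype ι'] [DecidableEq ι']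

/-- Relabelling the basis of a unitary matrix. -/
def relabel (e : ι ≃ ι') (U : unitaryGroup ι ℂ) : unitaryGroup ι' ℂ :=
  ⟨(U : Matrix ι ι ℂ).submatrix e.symm e.symm, by
    rw [mem_unitaryGroup_iff, star_eq_conjTranspose, conjTranspose_submatrix,
      submatrix_mul_equiv, ← star_eq_conjTranspose, Unitary.mul_star_self_of_mem U.2, submatrix_one_equiv]⟩

theorem relabel_apply (e : ι ≃ ι') (U : unitaryGroup ι ℂ) (i j : ι') :
    (relabel e U : Matrix ι' ι' ℂ) i j = (U : Matrix ι ι ℂ) (e.symm i) (e.symm j) := rfl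

theorem relabel_mul (e : ι ≃ ι') (U V : unitaryGroup ι ℂ) :
    relabel e (U * V) = relabel e U * relabel e V := by
  apply Subtype.ext
  simp [relabel, submatrix_mul_equiv]

variable {J : Type*} [Fintype J] [DecidableEq J] {κ : J → Type*} [∀ j, Fintype (κ j)]
  [∀ j, DecidableEq (κ j)]

/-- The block diagonal unitary matrix with given blocks. -/
def sigma (U : ∀ j, unitaryGroup (κ j) ℂ) : unitaryGroup (Σ j, κ j) ℂ :=
  ⟨blockDiagonal' fun j => (U j : Matrix (κ j) (κ j) ℂ), by
    rw [mem_unitaryGroup_iff, star_eq_conjTranspose, blockDiagonal'_conjTranspose,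
      ← blockDiagonal'_mul]
    simp_rw [← star_eq_conjTranspose, fun j => Unitary.mul_star_self_of_mem (U j).2]
    exact blockDiagonal'_one⟩

theorem coe_sigma (U : ∀ j, unitaryGroup (κ j) ℂ) :
    (sigma U : Matrix (Σ j, κ j) (Σ j, κ j) ℂ) =
      blockDiagonal' fun j => (U j : Matrix (κ j) (κ j) ℂ) := rfl

theorem sigma_mul (U V : ∀ j, unitaryGroup (κ j) ℂ) :
    sigma (fun j => U j * V j) = sigma U * sigma V := by
  apply Subtype.ext
  simp [sigma, blockDiagonal'_mul]

/-- A unitary on the second register controlled by the first. -/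
def control (U : J → unitaryGroup ι ℂ) : unitaryGroup (J × ι) ℂ :=
  relabel (Equiv.sigmaEquivProd J ι) (sigma U)

theorem control_apply (U : J → unitaryGroup ι ℂ) (j j' : J) (i i' : ι) :
    (control U : Matrix (J × ι) (J × ι) ℂ) (j, i) (j', i') =
      if j = j' then (U j : Matrix ι ι ℂ) i i' else 0 := by
  simp [control, relabel_apply, coe_sigma, blockDiagonal'_apply, Equiv.sigmaEquivProd]

/-- A unitary on the first of two registers. -/
def onFst (J : Type*) [Fintype J] [DecidableEq J] (U : unitaryGroup ι ℂ) :
    unitaryGroup (ι × J) ℂ :=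
  relabel (Equiv.prodComm J ι) (control fun _ => U)

theorem onFst_apply (U : unitaryGroup ι ℂ) (i i' : ι) (j j' : J) :
    (onFst J U : Matrix (ι × J) (ι × J) ℂ) (i, j) (i', j') =
      if j = j' then (U : Matrix ι ι ℂ) i i' else 0 := by
  simp [onFst, relabel_apply, control_apply]

end Matrix.unitaryGroup

/-! ### Circuits with phase queries -/

section

variable {X ι : Type*} [Fintype ι] [DecidableEq ι]

/-- The phase oracle that multiplies the basis vector `i` by `(-1)^(f x)` if `q i = some x`. -/
def phaseOracle (q : ι → Option X) (f : X → Bool) : Matrix.unitaryGroup ι ℂ :=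
  ⟨Matrix.diagonal fun i => (q i).elim 1 fun x => if f x then -1 else 1, by
    rw [Matrix.mem_unitaryGroup_iff, Matrix.star_eq_conjTranspose, Matrix.diagonal_conjTranspose,
      Matrix.diagonal_mul_diagonal, ← Matrix.diagonal_one]
    congr 1
    funext i
    cases h : q i with
    | none => simp [h]
    | some x => cases hf : f x <;> simp [h, hf]⟩

theorem coe_phaseOracle (q : ι → Option X) (f : X → Bool) :
    (phaseOracle q f : Matrix ι ι ℂ) =
      Matrix.diagonal fun i => (q i).elim 1 fun x => if f x then -1 else 1 := rfl

theorem phaseOracle_inv (q : ι → Option X) (f : X → Bool) :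
    (phaseOracle q f)⁻¹ = phaseOracle q f := by
  apply Subtype.ext
  rw [Matrix.UnitaryGroup.inv_val, coe_phaseOracle, Matrix.star_eq_conjTranspose,
    Matrix.diagonal_conjTranspose]
  congr 1
  funext i
  cases h : q i with
  | none => simp [h]
  | some x => cases hf : f x <;> simp [h, hf]

theorem phaseOracle_none (f : X → Bool) : phaseOracle (fun _ : ι => (none : Option X)) f = 1 := by
  apply Subtype.ext
  simp [coe_phaseOracle]

/-- Families of unitaries that can be implemented with `T` phase queries. -/
inductive IsQueryFamily : ℕ → ((X → Bool) → Matrix.unitaryGroup ι ℂ) → Prop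
  | const (V : Matrix.unitaryGroup ι ℂ) : IsQueryFamily 0 fun _ => V
  | step {T : ℕ} {M : (X → Bool) → Matrix.unitaryGroup ι ℂ} (V : Matrix.unitaryGroup ι ℂ)
      (q : ι → Option X) (h : IsQueryFamily T M) :
      IsQueryFamily (T + 1) fun f => V * phaseOracle q f * M f

namespace IsQueryFamily

variable {T T' : ℕ} {M M' : (X → Bool) → Matrix.unitaryGroup ι ℂ}

theorem congr (h : IsQueryFamily T M) (hM : ∀ f, M f = M' f) (hT : T = T') :
    IsQueryFamily T' M' := by
  rw [← hT, ← funext hM]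
  exact h

theorem exists_of_zero (h : IsQueryFamily 0 M) : ∃ V, M = fun _ => V := by
  cases h with
  | const V => exact ⟨V, rfl⟩

theorem exists_of_succ (h : IsQueryFamily (T + 1) M) :
    ∃ V q N, IsQueryFamily T N ∧ M = fun f => V * phaseOracle q f * N f := by
  cases h with
  | step V q h => exact ⟨V, q, _, h, rfl⟩

theorem phase (q : ι → Option X) : IsQueryFamily 1 (phaseOracle q) :=
  ((const 1).step 1 q).congr (by simp) rfl

theorem const_mul (V : Matrix.unitaryGroup ι ℂ) (h : IsQueryFamily T M) :
    IsQueryFamily T fun f => V * M f := by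
  cases h with
  | const W => exact const (V * W)
  | step W q h => exact (h.step (V * W) q).congr (by simp [mul_assoc]) rfl

theorem mul (h : IsQueryFamily T M) (h' : IsQueryFamily T' M') :
    IsQueryFamily (T + T') fun f => M f * M' f := by
  induction h with
  | const V => exact (h'.const_mul V).congr (fun _ => rfl) (by simp)
  | step V q _ ih => exact (ih.step V q).congr (by simp [mul_assoc]) (by omega)

theorem inv (h : IsQueryFamily T M) : IsQueryFamily T fun f => (M f)⁻¹ := by
  induction h with
  | const V => exact const V⁻¹
  | step V q _ ih =>
    exact ((ih.mul (phase q)).mul (const V⁻¹)).congr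
      (by simp [mul_assoc, phaseOracle_inv]) (by omega)

theorem succ (h : IsQueryFamily T M) : IsQueryFamily (T + 1) M :=
  (h.step 1 fun _ => none).congr (by simp [phaseOracle_none]) rfl

theorem mono (h : IsQueryFamily T M) (hT : T ≤ T') : IsQueryFamily T' M := by
  induction hT with
  | refl => exact h
  | step _ ih => exact ih.succ

theorem pow (h : IsQueryFamily T M) (k : ℕ) : IsQueryFamily (k * T) fun f => M f ^ k := by
  induction k with
  | zero => exact (const 1).congr (by simp) (by simp)
  | succ k ih => exact (ih.mul h).congr (by simp [pow_succ]) (by ring)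

theorem relabel {ι' : Type*} [Fintype ι'] [DecidableEq ι'] (h : IsQueryFamily T M) (e : ι ≃ ι') :
    IsQueryFamily T fun f => Matrix.unitaryGroup.relabel e (M f) := by
  induction h with
  | const V => exact const _
  | step V q _ ih =>
    refine (ih.step (Matrix.unitaryGroup.relabel e V) (q ∘ e.symm)).congr (fun f => ?_) rfl
    rw [Matrix.unitaryGroup.relabel_mul, Matrix.unitaryGroup.relabel_mul]
    congr 2
    apply Subtype.ext
    ext i j
    simp [Matrix.unitaryGroup.relabel_apply, coe_phaseOracle, Matrix.diagonal_apply]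

/-- A single phase query serves all blocks at once, since the queried point may depend on the basis
label. Peeling off the last query of every block simultaneously keeps the cost at `T` rather than
the sum over blocks. -/
theorem sigma {J : Type*} [Fintype J] [DecidableEq J] {κ : J → Type*} [∀ j, Fintype (κ j)]
    [∀ j, DecidableEq (κ j)] {M : ∀ j, (X → Bool) → Matrix.unitaryGroup (κ j) ℂ}
    (h : ∀ j, IsQueryFamily T (M j)) :
    IsQueryFamily T fun f => Matrix.unitaryGroup.sigma fun j => M j f := by
  induction T generalizing M with
  | zero =>
    have h0 : ∀ j, ∃ V, M j = fun _ => V := fun j => (h j).exists_of_zero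
    choose V hV using h0
    simp only [hV]
    exact const _
  | succ T ih =>
    have h1 := fun j => (h j).exists_of_succ
    choose V q N hN hM using h1
    refine ((ih hN).step (Matrix.unitaryGroup.sigma V) fun i => q i.1 i.2).congr (fun f => ?_) rfl
    simp only [hM, Matrix.unitaryGroup.sigma_mul]
    congr 2
    apply Subtype.ext
    rw [Matrix.unitaryGroup.coe_sigma]
    simp only [coe_phaseOracle]
    rw [Matrix.blockDiagonal'_diagonal]

theorem control {J : Type*} [Fintype J] [DecidableEq J]
    {M : J → (X → Bool) → Matrix.unitaryGroup ι ℂ} (h : ∀ j, IsQueryFamily T (M j)) :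
    IsQueryFamily T fun f => Matrix.unitaryGroup.control fun j => M j f :=
  (sigma h).relabel _

theorem onFst {J : Type*} [Fintype J] [DecidableEq J] (h : IsQueryFamily T M) :
    IsQueryFamily T fun f => Matrix.unitaryGroup.onFst J (M f) :=
  (control fun _ : J => h).relabel _

end IsQueryFamily

/-- The distribution of the outcome when the state `U |j⟩` is measured. -/
noncomputable def bornPMF (U : Matrix.unitaryGroup ι ℂ) (j : ι) : PMF ι :=
  PMF.ofFintype (fun i => ENNReal.ofReal (‖(U : Matrix ι ι ℂ) i j‖ ^ 2)) (by
    rw [← ENNReal.ofReal_sum_of_nonneg fun _ _ => by positivity, sum_normSq_col,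
      ENNReal.ofReal_one])

theorem bornPMF_apply (U : Matrix.unitaryGroup ι ℂ) (j i : ι) :
    bornPMF U j i = ENNReal.ofReal (‖(U : Matrix ι ι ℂ) i j‖ ^ 2) := rfl

end

/-! ### Quantum sampling and sequential composition -/

/-- Families of output distributions that a quantum algorithm samples with `T` queries. -/
def QuerySamplable {X O : Type} (T : ℕ) (μ : (X → Bool) → PMF O) : Prop :=
  ∃ (ι : Type) (_ : Fintype ι) (_ : DecidableEq ι) (j : ι)
    (M : (X → Bool) → Matrix.unitaryGroup ι ℂ) (out : ι → O),
    IsQueryFamily T M ∧ ∀ f, μ f = (bornPMF (M f) j).map out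

namespace QuerySamplable

variable {X O O' : Type} {T T' : ℕ} {μ : (X → Bool) → PMF O}

theorem mono (h : QuerySamplable T μ) (hT : T ≤ T') : QuerySamplable T' μ := by
  obtain ⟨ι, _, _, j, M, out, hM, hμ⟩ := h
  exact ⟨ι, _, _, j, M, out, hM.mono hT, hμ⟩

theorem map (h : QuerySamplable T μ) (g : O → O') : QuerySamplable T fun f => (μ f).map g := by
  obtain ⟨ι, _, _, j, M, out, hM, hμ⟩ := h
  exact ⟨ι, _, _, j, M, g ∘ out, hM, fun f => by simp only [hμ, PMF.map_comp]⟩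

theorem pure (X : Type) (o : O) : QuerySamplable 0 fun _ : X → Bool => PMF.pure o :=
  ⟨Unit, _, _, (), fun _ => 1, fun _ => o, .const 1, fun _ => (PMF.map_const _ _).symm⟩

open Matrix.unitaryGroup in
/-- Finitely many algorithms can be run on a common register, from a common initial state. -/
theorem exists_common {J : Type} [Fintype J] [DecidableEq J] [Nonempty J]
    {ν : J → (X → Bool) → PMF O} (h : ∀ j, QuerySamplable T (ν j)) :
    ∃ (ι : Type) (_ : Fintype ι) (_ : DecidableEq ι) (k : ι)
      (M : J → (X → Bool) → Matrix.unitaryGroup ι ℂ) (out : J → ι → O),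
      ∀ j, IsQueryFamily T (M j) ∧ ∀ f, ν j f = (bornPMF (M j f) k).map (out j) := by
  choose κ _ _ k M out hM hν using h
  let j₀ : J := Classical.arbitrary J
  -- `V j` carries the common initial vector to the initial vector of block `j`; then only that
  -- block is run.
  have hV : ∀ j, ∃ V : Matrix.unitaryGroup (Σ j, κ j) ℂ,
      ∀ i, (V : Matrix (Σ j, κ j) (Σ j, κ j) ℂ) i ⟨j₀, k j₀⟩ =
        Pi.single (M := fun _ => ℂ) (⟨j, k j⟩ : Σ j, κ j) (1 : ℂ) i := fun j =>
    exists_unitary_col _ _ (by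
      rw [Finset.sum_eq_single (⟨j, k j⟩ : Σ j, κ j) (fun b _ hb => by simp [hb]) (by simp)]
      simp)
  choose V hV using hV
  refine ⟨Σ j, κ j, inferInstance, inferInstance, ⟨j₀, k j₀⟩,
    fun j f => sigma (fun i => if i = j then M i f else 1) * V j, fun _ i => out i.1 i.2,
    fun j => ⟨?_, fun f => ?_⟩⟩
  · refine (IsQueryFamily.sigma fun i => ?_).mul (.const (V j))
    by_cases hij : i = j
    · simpa [hij] using hM i
    · simpa [hij] using (IsQueryFamily.const 1).mono (Nat.zero_le T)
  · have hcol : bornPMF (sigma (fun i => if i = j then M i f else 1) * V j) ⟨j₀, k j₀⟩ =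
        (bornPMF (M j f) (k j)).map (Sigma.mk j) := by
      ext ⟨i, l⟩
      rw [PMF.map_apply, bornPMF_apply, Matrix.UnitaryGroup.mul_val, Matrix.mul_apply]
      simp only [hV, coe_sigma, Matrix.blockDiagonal'_apply]
      rw [Finset.sum_eq_single (⟨j, k j⟩ : Σ j, κ j) (fun b _ hb => by simp [hb]) (by simp)]
      by_cases hij : i = j
      · subst hij
        rw [tsum_eq_single l]
        · simp [bornPMF_apply]
        · intro b hb
          simp [hb.symm]
      · simp [hij]
    rw [hcol, hν, PMF.map_comp]
    rfl

open Matrix.unitaryGroup in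
-- Deferred measurement: the first register is left unmeasured and controls the second computation.
-- The control preserves its basis label, so the final measurement has the law of the two-stage
-- experiment. The branches share their queries, hence `T'` is paid once.
theorem bind (h : QuerySamplable T μ) {ν : O → (X → Bool) → PMF O'}
    (h' : ∀ o, QuerySamplable T' (ν o)) :
    QuerySamplable (T + T') fun f => (μ f).bind fun o => ν o f := by
  obtain ⟨ι, _, _, i₀, A, out, hA, hμ⟩ := h
  have : Nonempty ι := ⟨i₀⟩
  obtain ⟨κ, _, _, k₀, B, out', hB⟩ := exists_common fun i => h' (out i)
  refine ⟨ι × κ, inferInstance, inferInstance, (i₀, k₀),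
    fun f => control (fun i => B i f) * onFst κ (A f), fun p => out' p.1 p.2,
    ((IsQueryFamily.control fun i => (hB i).1).mul hA.onFst).congr (fun _ => rfl) (add_comm _ _),
    fun f => ?_⟩
  have hcol : bornPMF (control (fun i => B i f) * onFst κ (A f)) (i₀, k₀) =
      (bornPMF (A f) i₀).bind fun i => (bornPMF (B i f) k₀).map (Prod.mk i) := by
    ext ⟨i, k⟩
    rw [PMF.bind_apply, tsum_eq_single i, PMF.map_apply, tsum_eq_single k]
    · simp only [bornPMF_apply, if_true]
      rw [Matrix.UnitaryGroup.mul_val, Matrix.mul_apply, Finset.sum_eq_single (i, k₀)]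
      · rw [control_apply, onFst_apply, if_pos rfl, if_pos rfl,
          ← ENNReal.ofReal_mul (by positivity), norm_mul, mul_pow, mul_comm]
      · rintro ⟨i', k'⟩ - hne
        rw [control_apply, onFst_apply]
        by_cases h1 : i = i'
        · subst h1
          have : k' ≠ k₀ := fun h => hne (by rw [h])
          simp [this]
        · simp [h1]
      · simp
    · intro b hb
      simp [hb.symm]
    · intro b hb
      rw [PMF.map_apply]
      simp [hb.symm]
  simp only [hcol, PMF.map_bind, hμ, PMF.bind_map]
  congr 1
  funext i
  rw [PMF.map_comp, Function.comp_apply, (hB i).2 f]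
  rfl

end QuerySamplable

/-! ### Sampling from the squared Walsh spectrum -/

theorem bitSign_xor (b c : Bool) : bitSign (xor b c) = bitSign b * bitSign c := by
  cases b <;> cases c <;> simp [bitSign]

theorem bitSign_bitDot {n : ℕ} (x a : Fin n → Bool) :
    bitSign (bitDot x a) = ∏ i, if x i = true ∧ a i = true then (-1 : ℝ) else 1 := by
  rw [Finset.prod_ite, Finset.prod_const, Finset.prod_const_one, mul_one]
  rcases Nat.even_or_odd (Finset.univ.filter fun i => x i = true ∧ a i = true).card with h | h
  · rw [h.neg_one_pow]
    simp [bitSign, bitDot, Nat.not_odd_iff_even.2 h]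
  · rw [h.neg_one_pow]
    simp [bitSign, bitDot, h]

theorem sum_bitSign_mul_bitSign {n : ℕ} (a b : Fin n → Bool) :
    ∑ x, bitSign (bitDot x a) * bitSign (bitDot x b) = if a = b then (2 : ℝ) ^ n else 0 := by
  simp only [bitSign_bitDot, ← Finset.prod_mul_distrib]
  rw [← Fintype.prod_sum fun (i : Fin n) (c : Bool) =>
    (if c = true ∧ a i = true then (-1 : ℝ) else 1) * if c = true ∧ b i = true then (-1 : ℝ) else 1]
  have h : ∀ i, (∑ c : Bool, (if c = true ∧ a i = true then (-1 : ℝ) else 1) *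
      if c = true ∧ b i = true then (-1 : ℝ) else 1) = if a i = b i then 2 else 0 := by
    intro i
    cases a i <;> cases b i <;> norm_num
  simp only [h]
  split_ifs with hab
  · simp [hab]
  · obtain ⟨i, hi⟩ := Function.ne_iff.1 hab
    exact Finset.prod_eq_zero (Finset.mem_univ i) (by simp [hi])

theorem sum_hadamard_mul {n : ℕ} (a b : Fin n → Bool) :
    ∑ x, ((√(2 ^ n))⁻¹ * bitSign (bitDot x a)) * ((√(2 ^ n))⁻¹ * bitSign (bitDot x b)) =
      if a = b then 1 else 0 := by
  have h2 : (√(2 ^ n : ℝ))⁻¹ * (√(2 ^ n))⁻¹ = (2 ^ n)⁻¹ := by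
    rw [← mul_inv, Real.mul_self_sqrt (by positivity)]
  have h : ∀ x, (√(2 ^ n))⁻¹ * bitSign (bitDot x a) * ((√(2 ^ n))⁻¹ * bitSign (bitDot x b)) =
      (2 ^ n)⁻¹ * (bitSign (bitDot x a) * bitSign (bitDot x b)) := by
    intro x
    rw [← h2]
    ring
  simp only [h]
  rw [← Finset.mul_sum, sum_bitSign_mul_bitSign]
  split_ifs <;> simp

/-- The Hadamard transform on `n` qubits. -/
noncomputable def hadamard (n : ℕ) : Matrix.unitaryGroup (Fin n → Bool) ℂ :=
  ⟨Matrix.of fun a x => (((√(2 ^ n))⁻¹ * bitSign (bitDot x a) : ℝ) : ℂ), by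
    rw [Matrix.mem_unitaryGroup_iff]
    ext a b
    rw [Matrix.mul_apply, Matrix.one_apply]
    simp only [Matrix.star_apply, Matrix.of_apply, RCLike.star_def, Complex.conj_ofReal]
    have h := congrArg Complex.ofReal (sum_hadamard_mul a b)
    rw [Complex.ofReal_sum] at h
    simpa [apply_ite Complex.ofReal] using h⟩

theorem hadamard_apply {n : ℕ} (a x : Fin n → Bool) :
    (hadamard n : Matrix _ _ ℂ) a x = (((√(2 ^ n))⁻¹ * bitSign (bitDot x a) : ℝ) : ℂ) := rfl

/-- One query suffices to sample `a` with probability `f̂(a)²`. -/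
theorem exists_walsh_sampler (n : ℕ) :
    ∃ μ : ((Fin n → Bool) → Bool) → PMF (Fin n → Bool), QuerySamplable 1 μ ∧
      ∀ f a, μ f a = ENNReal.ofReal (walshCoeff f a ^ 2) := by
  refine ⟨fun f => bornPMF (hadamard n * phaseOracle some f * hadamard n) (fun _ : Fin n => false),
    ⟨_, inferInstance, inferInstance, fun _ => false, _, id,
      (((IsQueryFamily.phase some).const_mul (hadamard n)).mul (.const (hadamard n))),
      fun f => (PMF.map_id _).symm⟩, fun f a => ?_⟩
  rw [bornPMF_apply]
  have h : ((hadamard n * phaseOracle some f * hadamard n : Matrix.unitaryGroup (Fin n → Bool) ℂ) :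
      Matrix (Fin n → Bool) (Fin n → Bool) ℂ) a (fun _ : Fin n => false) = (walshCoeff f a : ℂ) := by
    rw [Matrix.UnitaryGroup.mul_val, Matrix.UnitaryGroup.mul_val, Matrix.mul_apply, coe_phaseOracle]
    simp only [Matrix.mul_diagonal, hadamard_apply, Option.elim_some]
    rw [walshCoeff, Finset.mul_sum, Complex.ofReal_sum]
    refine Finset.sum_congr rfl fun x _ => ?_
    have h0 : bitSign (bitDot (fun _ => false) x) = 1 := by simp [bitDot, bitSign]
    have h1 : (if f x = true then (-1 : ℂ) else 1) = (bitSign (f x) : ℂ) := by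
      cases f x <;> simp [bitSign]
    have h2 : (√(2 ^ n : ℝ))⁻¹ * (√(2 ^ n))⁻¹ = 1 / 2 ^ n := by
      rw [← mul_inv, Real.mul_self_sqrt (by positivity), one_div]
    rw [h0, h1, bitSign_xor, ← h2]
    push_cast
    ring
  rw [h, Complex.norm_real, Real.norm_eq_abs, sq_abs]

/-! ### From phase queries to the oracle `U_f` -/

section

open Matrix Matrix.unitaryGroup

variable {n : ℕ} {ι : Type} [Fintype ι] [DecidableEq ι]

/-- The amplitudes after `t` oracle calls of the algorithm with unitaries `V`, started in `j`. -/
noncomputable def oracleState (V : ℕ → unitaryGroup (QueryBasis n ι) ℂ) (j : QueryBasis n ι)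
    (f : (Fin n → Bool) → Bool) : ℕ → QueryBasis n ι → ℂ
  | 0 => (V 0 : Matrix (QueryBasis n ι) (QueryBasis n ι) ℂ).mulVec (Pi.single j 1)
  | t + 1 => (V (t + 1) : Matrix (QueryBasis n ι) (QueryBasis n ι) ℂ).mulVec
      (applyOracle f (oracleState V j f t))

theorem oracleState_congr {V V' : ℕ → unitaryGroup (QueryBasis n ι) ℂ} (j : QueryBasis n ι)
    (f : (Fin n → Bool) → Bool) {T : ℕ} (h : ∀ t ≤ T, V t = V' t) :
    oracleState V j f T = oracleState V' j f T := by
  induction T with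
  | zero => simp only [oracleState, h 0 le_rfl]
  | succ T ih =>
    simp only [oracleState, h (T + 1) le_rfl, ih fun t ht => h t (ht.trans (Nat.le_succ T))]

theorem oracleState_update (V : ℕ → unitaryGroup (QueryBasis n ι) ℂ) (j : QueryBasis n ι)
    (f : (Fin n → Bool) → Bool) (T : ℕ) (U : unitaryGroup (QueryBasis n ι) ℂ) :
    oracleState (Function.update V T (U * V T)) j f T =
      (U : Matrix (QueryBasis n ι) (QueryBasis n ι) ℂ).mulVec (oracleState V j f T) := by
  cases T with
  | zero => simp only [oracleState, Function.update_self, UnitaryGroup.mul_val, mulVec_mulVec]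
  | succ T =>
    have h : oracleState (Function.update V (T + 1) (U * V (T + 1))) j f T =
        oracleState V j f T :=
      oracleState_congr _ _ fun t ht => Function.update_of_ne (by omega) _ _
    simp [oracleState, h]

/-- The state `|0⟩|0⟩|ψ⟩`. -/
def padState (n : ℕ) (ψ : ι → ℂ) : QueryBasis n ι → ℂ :=
  fun p => if p.1 = (fun _ => false) ∧ p.2.1 = false then ψ p.2.2 else 0

theorem padState_single {ι : Type} [DecidableEq ι] (j : ι) :
    padState n (Pi.single j 1) = Pi.single ((fun _ => false), false, j) (1 : ℂ) := by
  funext ⟨x, b, i⟩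
  simp only [padState, Pi.single_apply, Prod.mk.injEq]
  split_ifs <;> simp_all

theorem control_mulVec_padState (V : unitaryGroup ι ℂ) (ψ : ι → ℂ) :
    ((control fun _ : Fin n → Bool => control fun _ : Bool => V :
      unitaryGroup (QueryBasis n ι) ℂ) : Matrix (QueryBasis n ι) (QueryBasis n ι) ℂ).mulVec
        (padState n ψ) = padState n ((V : Matrix ι ι ℂ).mulVec ψ) := by
  funext ⟨x, b, i⟩
  simp only [mulVec, dotProduct, Fintype.sum_prod_type, control_apply, padState]
  rw [Finset.sum_eq_single x (fun y _ hy => by simp [hy.symm]) (by simp),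
    Finset.sum_eq_single b (fun y _ hy => by simp [hy.symm]) (by simp)]
  simp only [if_true]
  split_ifs <;> simp

/-- The states of the query and answer registers on which the oracle acts as a phase. -/
noncomputable def kickbackState (n : ℕ) : Option (Fin n → Bool) → (Fin n → Bool) × Bool → ℂ
  | none, p => if p.1 = (fun _ => false) then ((√2)⁻¹ : ℝ) else 0
  | some x, p => if p.1 = x then ((√2)⁻¹ * bitSign p.2 : ℝ) else 0

theorem sum_normSq_kickbackState (q : Option (Fin n → Bool)) :
    ∑ p, ‖kickbackState n q p‖ ^ 2 = 1 := by
  have h2 : ((√2 : ℝ)⁻¹) ^ 2 = 1 / 2 := by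
    rw [inv_pow, Real.sq_sqrt zero_le_two, one_div]
  rw [Fintype.sum_prod_type]
  cases q with
  | none =>
    rw [Finset.sum_eq_single (fun _ => false) (fun y _ hy => by simp [kickbackState, hy]) (by simp)]
    simp only [kickbackState, if_true, Fintype.sum_bool, Complex.norm_real, Real.norm_eq_abs,
      sq_abs, h2]
    norm_num
  | some x =>
    rw [Finset.sum_eq_single x (fun y _ hy => by simp [kickbackState, hy]) (by simp)]
    simp only [kickbackState, if_true, Fintype.sum_bool, Complex.norm_real, Real.norm_eq_abs,
      sq_abs, mul_pow, h2, bitSign]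
    norm_num

/-- For `none` the answer qubit is `|+⟩`, fixed by a bit flip; for `some x` it is `|-⟩`, negated
exactly when `f x` flips it. -/
theorem kickbackState_oracle (f : (Fin n → Bool) → Bool) (q : Option (Fin n → Bool))
    (x : Fin n → Bool) (b : Bool) :
    kickbackState n q (x, xor b (f x)) =
      (q.elim 1 fun y => if f y then -1 else 1) * kickbackState n q (x, b) := by
  cases q with
  | none => simp [kickbackState]
  | some y =>
    by_cases hxy : x = y
    · subst hxy
      cases h : f x <;> cases b <;> simp [kickbackState, h, bitSign]
    · simp [kickbackState, hxy]

/-- A phase query is an oracle call between unitaries that do not depend on the oracle. -/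
theorem exists_phase_kickback (q : ι → Option (Fin n → Bool)) :
    ∃ Γ : unitaryGroup (QueryBasis n ι) ℂ, ∀ f (ψ : ι → ℂ),
      applyOracle f ((Γ : Matrix (QueryBasis n ι) (QueryBasis n ι) ℂ).mulVec (padState n ψ)) =
        (Γ : Matrix (QueryBasis n ι) (QueryBasis n ι) ℂ).mulVec
          (padState n ((phaseOracle q f : Matrix ι ι ℂ).mulVec ψ)) := by
  choose G hG using fun i => exists_unitary_col ((fun _ => false), false)
    (kickbackState n (q i)) (sum_normSq_kickbackState (q i))
  let e : ι × ((Fin n → Bool) × Bool) ≃ QueryBasis n ι :=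
    (Equiv.prodComm _ _).trans (Equiv.prodAssoc _ _ _)
  have hΓ : ∀ (ψ : ι → ℂ) x b i, ((relabel e (control G) : unitaryGroup (QueryBasis n ι) ℂ) :
      Matrix (QueryBasis n ι) (QueryBasis n ι) ℂ).mulVec (padState n ψ) (x, b, i) =
        kickbackState n (q i) (x, b) * ψ i := by
    intro ψ x b i
    simp only [mulVec, dotProduct, padState, relabel_apply]
    rw [Finset.sum_eq_single ((fun _ => false), false, i)]
    · simp [e, control_apply, hG]
    · rintro ⟨y, c, j⟩ - hne
      by_cases h1 : y = (fun _ => false) ∧ c = false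
      · obtain ⟨rfl, rfl⟩ := h1
        have : i ≠ j := fun h => hne (by rw [h])
        simp [e, control_apply, this]
      · simp [h1]
    · simp
  refine ⟨relabel e (control G), fun f ψ => ?_⟩
  funext ⟨x, b, i⟩
  rw [hΓ]
  simp only [applyOracle]
  rw [hΓ, kickbackState_oracle, coe_phaseOracle, mulVec_diagonal]
  ring

/-- On padded states a phase query is `Γ⁻¹ U_f Γ`. The factor `Γ` is absorbed into the unitary
before the oracle call and `Γ⁻¹` into the one after it, so the number of calls is unchanged. -/
theorem IsQueryFamily.exists_oracleState {T : ℕ}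
    {M : ((Fin n → Bool) → Bool) → unitaryGroup ι ℂ} (h : IsQueryFamily T M) (j : ι) :
    ∃ V : ℕ → unitaryGroup (QueryBasis n ι) ℂ, ∀ f,
      oracleState V ((fun _ => false), false, j) f T =
        padState n ((M f : Matrix ι ι ℂ).mulVec (Pi.single j 1)) := by
  induction h with
  | const W =>
    refine ⟨fun _ => Matrix.unitaryGroup.control fun _ => Matrix.unitaryGroup.control fun _ => W, fun f => ?_⟩
    rw [← control_mulVec_padState, padState_single]
    rfl
  | @step T M W q h ih =>
    obtain ⟨V, hV⟩ := ih
    obtain ⟨Γ, hΓ⟩ := exists_phase_kickback q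
    refine ⟨Function.update (Function.update V T (Γ * V T)) (T + 1)
      ((Matrix.unitaryGroup.control fun _ => Matrix.unitaryGroup.control fun _ => W) * Γ⁻¹), fun f => ?_⟩
    have h1 : oracleState (Function.update (Function.update V T (Γ * V T)) (T + 1)
        ((Matrix.unitaryGroup.control fun _ => Matrix.unitaryGroup.control fun _ => W) * Γ⁻¹)) ((fun _ => false), false, j) f T =
        (Γ : Matrix (QueryBasis n ι) (QueryBasis n ι) ℂ).mulVec
          (padState n ((M f : Matrix ι ι ℂ).mulVec (Pi.single j 1))) := by
      rw [← hV, ← oracleState_update]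
      exact oracleState_congr _ _ fun t ht => Function.update_of_ne (by omega) _ _
    rw [oracleState, h1, hΓ, Function.update_self, UnitaryGroup.mul_val, UnitaryGroup.inv_val,
      mulVec_mulVec, Matrix.mul_assoc, Unitary.star_mul_self_of_mem Γ.2, Matrix.mul_one,
      control_mulVec_padState]
    simp only [mulVec_mulVec, UnitaryGroup.mul_val, Matrix.mul_assoc]

theorem QuantumQueryAlgorithm.state_eq_oracleState {O : Type} (A : QuantumQueryAlgorithm n O)
    (f : (Fin n → Bool) → Bool) (t : ℕ) : A.state f t = oracleState A.V A.init f t := by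
  induction t with
  | zero => rfl
  | succ t ih => rw [state, oracleState, ih]

/-- Sampling with `T` queries is realised by a quantum query algorithm with `T` oracle calls. -/
theorem QuerySamplable.exists_quantumQueryAlgorithm {O : Type} {T : ℕ}
    {μ : ((Fin n → Bool) → Bool) → PMF O} (h : QuerySamplable T μ) {P : O → Prop}
    (hP : ∀ f, ∀ o ∈ (μ f).support, P o) (o₀ : O) (ho₀ : P o₀) :
    ∃ A : QuantumQueryAlgorithm n O, A.queries = T ∧ (∀ i, P (A.out i)) ∧
      ∀ f S, A.prob f S = ((μ f).toOuterMeasure S).toReal := by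
  classical
  obtain ⟨ι, _, _, j, M, out, hM, hμ⟩ := h
  obtain ⟨V, hV⟩ := hM.exists_oracleState j
  let A : QuantumQueryAlgorithm n O :=
    { W := ι
      init := (fun _ => false, false, j)
      queries := T
      V := V
      -- `P` must hold for every basis label, including those of probability zero, about which `hP`
      -- says nothing; there the output is replaced by `o₀`.
      out := fun p => if P (out p.2.2) then out p.2.2 else o₀ }
  refine ⟨A, rfl, fun i => ?_, fun f S => ?_⟩
  · by_cases hi : P (out i.2.2)
    · simp [A, hi]
    · simpa [A, hi] using ho₀
  have hstate : A.state f A.queries =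
      padState n ((M f : Matrix ι ι ℂ).mulVec (Pi.single j 1)) := by
    rw [A.state_eq_oracleState, ← hV f]
  have hout : ∀ i, bornPMF (M f) j i ≠ 0 → P (out i) := fun i hi =>
    hP f _ (by
      rw [hμ, PMF.mem_support_map_iff]
      exact ⟨i, (PMF.mem_support_iff _ _).2 hi, rfl⟩)
  rw [hμ, PMF.toOuterMeasure_map_apply, PMF.toOuterMeasure_apply_fintype, ENNReal.toReal_sum
    fun i _ => ?_]
  · simp only [QuantumQueryAlgorithm.prob, hstate]
    rw [Fintype.sum_prod_type, Finset.sum_eq_single (fun _ => false)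
      (fun y _ hy => by simp [padState, hy]) (by simp), Fintype.sum_prod_type,
      Finset.sum_eq_single false (fun y _ hy => by simp [padState, hy]) (by simp)]
    refine Finset.sum_congr rfl fun i _ => ?_
    simp only [padState, and_self, if_true, mulVec_single_one, col_apply, A]
    by_cases h0 : bornPMF (M f) j i = 0
    · have h1 : ‖(M f : Matrix ι ι ℂ) i j‖ ^ 2 = 0 := by
        rw [bornPMF_apply, ENNReal.ofReal_eq_zero] at h0
        exact le_antisymm h0 (by positivity)
      rw [h1, Set.indicator_apply, h0]
      simp
    · rw [if_pos (hout i h0), Set.indicator_apply]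
      simp only [Set.mem_preimage]
      split_ifs
      · rw [bornPMF_apply, ENNReal.toReal_ofReal (by positivity)]
      · simp
  · rw [Set.indicator_apply]
    split_ifs
    · exact PMF.apply_ne_top _ _
    · simp

end

/-! ### Majority voting -/

open scoped ENNReal

namespace PMF

theorem tsum_bind_mul {α β : Type*} (p : PMF α) (q : α → PMF β) (h : β → ℝ≥0∞) :
    ∑' b, p.bind q b * h b = ∑' a, p a * ∑' b, q a b * h b := by
  simp only [bind_apply, ← ENNReal.tsum_mul_right, ← ENNReal.tsum_mul_left]
  rw [ENNReal.tsum_comm]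
  simp only [mul_assoc]

theorem tsum_map_mul {α β : Type*} (p : PMF α) (g : α → β) (h : β → ℝ≥0∞) :
    ∑' b, p.map g b * h b = ∑' a, p a * h (g a) := by
  rw [← bind_pure_comp, tsum_bind_mul]
  congr 1
  funext a
  rw [tsum_eq_single (g a) fun b hb => by simp [hb]]
  simp

theorem toReal_add_toReal_bool (p : PMF Bool) : (p false).toReal + (p true).toReal = 1 := by
  rw [← ENNReal.toReal_add (p.apply_ne_top _) (p.apply_ne_top _), ← ENNReal.toReal_one,
    ← p.tsum_coe, tsum_fintype, Fintype.sum_bool, add_comm]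

theorem toReal_bind_apply {α β : Type*} [Fintype α] (p : PMF α) (q : α → PMF β) (b : β) :
    (p.bind q b).toReal = ∑ a, (p a).toReal * (q a b).toReal := by
  rw [bind_apply, tsum_fintype, ENNReal.toReal_sum fun a _ =>
    ENNReal.mul_ne_top (p.apply_ne_top _) ((q a).apply_ne_top _)]
  simp only [ENNReal.toReal_mul]

theorem sum_toReal {α : Type*} [Fintype α] (p : PMF α) : ∑ a, (p a).toReal = 1 := by
  rw [← ENNReal.toReal_sum fun a _ => p.apply_ne_top a, ← tsum_fintype (L := .unconditional _),
    p.tsum_coe, ENNReal.toReal_one]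

theorem toReal_apply_le_one {α : Type*} (p : PMF α) (a : α) : (p a).toReal ≤ 1 :=
  ENNReal.toReal_le_of_le_ofReal zero_le_one (by simpa using p.coe_le_one a)

/-- The number of outcomes `true` in `m` independent runs. -/
noncomputable def hits (p : PMF Bool) : ℕ → PMF ℕ
  | 0 => pure 0
  | m + 1 => p.bind fun b => (hits p m).map fun c => c + if b then 1 else 0

theorem tsum_hits_mul_pow (p : PMF Bool) (z : ℝ≥0∞) (m : ℕ) :
    ∑' c, p.hits m c * z ^ c = (p false + p true * z) ^ m := by
  induction m with
  | zero =>
    rw [tsum_eq_single 0 fun c hc => by simp [hits, hc]]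
    simp [hits]
  | succ m ih =>
    simp only [hits, tsum_bind_mul, tsum_map_mul, tsum_fintype, Fintype.sum_bool]
    simp only [if_true, Bool.false_eq_true, if_false, add_zero, pow_succ, ← mul_assoc,
      ENNReal.tsum_mul_right, ih]
    ring

/-- The majority of `m` independent runs. -/
noncomputable def majority (p : PMF Bool) (m : ℕ) : PMF Bool :=
  (p.hits m).map fun c => decide (m ≤ 2 * c)

/-- Markov's inequality for `z ^ c * w ^ m`, whose expectation is given by the generating function
of the number of hits. -/
theorem tsum_majority_le (p : PMF Bool) (m : ℕ) (b : Bool) (z w : ℝ) (hz : 0 ≤ z) (hw : 0 ≤ w)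
    (h : ∀ c, decide (m ≤ 2 * c) = b → 1 ≤ z ^ c * w ^ m) :
    (p.majority m b).toReal ≤ (((p false).toReal + (p true).toReal * z) * w) ^ m := by
  have key : p.majority m b ≤
      (p false + p true * ENNReal.ofReal z) ^ m * ENNReal.ofReal w ^ m := by
    rw [← tsum_hits_mul_pow, ← ENNReal.tsum_mul_right, majority, map_apply]
    refine ENNReal.tsum_le_tsum fun c => ?_
    split_ifs with hc
    · rw [mul_assoc, ← ENNReal.ofReal_pow hz, ← ENNReal.ofReal_pow hw,
        ← ENNReal.ofReal_mul (by positivity)]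
      exact le_mul_of_one_le_right' (ENNReal.one_le_ofReal.2 (h c hc.symm))
    · exact zero_le
  refine (ENNReal.toReal_mono ?_ key).trans_eq ?_
  · have := p.apply_ne_top true
    have := p.apply_ne_top false
    finiteness
  · rw [ENNReal.toReal_mul, ENNReal.toReal_pow, ENNReal.toReal_pow, ENNReal.toReal_add
      (p.apply_ne_top _) (ENNReal.mul_ne_top (p.apply_ne_top _) ENNReal.ofReal_ne_top),
      ENNReal.toReal_mul, ENNReal.toReal_ofReal hz, ENNReal.toReal_ofReal hw, mul_pow]

/-- The majority vote is wrong with exponentially small probability. -/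
theorem majority_le (p : PMF Bool) (m : ℕ) (b : Bool) (hp : (p b).toReal ≤ 1 / 8) :
    (p.majority m b).toReal ≤ (11 / 16) ^ m := by
  have h1 := p.toReal_add_toReal_bool
  have h2 : 0 ≤ (p true).toReal := ENNReal.toReal_nonneg
  have h3 : 0 ≤ (p false).toReal := ENNReal.toReal_nonneg
  cases b with
  | true =>
    -- With `q ≤ 1/8` the probability of a wrong vote, `((1 - q) + 4 q) / 2 ≤ 11/16`. The other case
    -- gives the same value with `z = 1/4`, `w = 2`.
    refine (tsum_majority_le p m true 4 (1 / 2) (by norm_num) (by norm_num) fun c hc => ?_).trans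
      (pow_le_pow_left₀ (by positivity) (by linarith) m)
    have hc' : m ≤ 2 * c := of_decide_eq_true hc
    calc (1 : ℝ) = 4 ^ c * (1 / 2) ^ (2 * c) := by
          rw [pow_mul, ← mul_pow]; norm_num
      _ ≤ _ := mul_le_mul_of_nonneg_left
          (pow_le_pow_of_le_one (by norm_num) (by norm_num) hc') (by positivity)
  | false =>
    refine (tsum_majority_le p m false (1 / 4) 2 (by norm_num) (by norm_num) fun c hc => ?_).trans
      (pow_le_pow_left₀ (by positivity) (by linarith) m)
    have hc' : 2 * c ≤ m := by
      have := of_decide_eq_false hc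
      omega
    calc (1 : ℝ) = (1 / 4) ^ c * 2 ^ (2 * c) := by
          rw [pow_mul, ← mul_pow]; norm_num
      _ ≤ _ := mul_le_mul_of_nonneg_left
          (pow_le_pow_right₀ (by norm_num) hc') (by positivity)

end PMF

theorem QuerySamplable.majority {X : Type} {T : ℕ} {μ : (X → Bool) → PMF Bool}
    (h : QuerySamplable T μ) (m : ℕ) : QuerySamplable (m * T) fun f => (μ f).majority m := by
  refine QuerySamplable.map (μ := fun f => (μ f).hits m) ?_ _
  induction m with
  | zero => exact (QuerySamplable.pure X 0).mono (by simp)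
  | succ m ih =>
    exact (h.bind (ν := fun b f => ((μ f).hits m).map fun c => c + if b then 1 else 0)
      fun b => ih.map _).mono (by rw [Nat.succ_mul, add_comm])

/-! ### Amplitude estimation through a three-term recurrence -/

/-- The squared norm of `a + b` forces `Re ⟨a, b⟩ = 2 x² - 1`, the only unknown in the expansion. -/
theorem normSq_comb_of_three_term {E : Type*} [NormedAddCommGroup E] [InnerProductSpace ℂ E]
    {a b c : E} {x : ℝ} (ha : ‖a‖ = 1) (hb : ‖b‖ = 1) (hc : ‖c‖ = 1)
    (h : a + b = ((2 * x : ℝ) : ℂ) • c) (β γ : ℝ) :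
    ‖(β : ℂ) • a + (γ : ℂ) • b‖ ^ 2 = (β + γ) ^ 2 * x ^ 2 + (β - γ) ^ 2 * (1 - x ^ 2) := by
  have h1 : ‖a + b‖ ^ 2 = 4 * x ^ 2 := by
    rw [h, norm_smul, hc, mul_one, Complex.norm_real, Real.norm_eq_abs, sq_abs]
    ring
  rw [norm_add_sq (𝕜 := ℂ), ha, hb] at h1
  rw [norm_add_sq (𝕜 := ℂ), norm_smul, norm_smul, ha, hb, inner_smul_left, inner_smul_right,
    Complex.conj_ofReal, Complex.norm_real, Complex.norm_real, Real.norm_eq_abs, Real.norm_eq_abs,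
    mul_one, mul_one, sq_abs, sq_abs]
  have h2 : RCLike.re ((β : ℂ) * ((γ : ℂ) * inner ℂ a b)) = β * γ * RCLike.re (inner ℂ a b) := by
    simp [mul_assoc]
  rw [h2]
  linear_combination (β * γ) * h1

/-- The second moment of the error of a spectral measurement on `∑ₖ αₖ |k⟩ gₖ`, for a sequence with
`gₖ₊₁ + gₖ₋₁ = 2 x gₖ`, if `α` is an eigenvector of the path. -/
theorem sum_normSq_three_term_le {E : Type*} [NormedAddCommGroup E] [InnerProductSpace ℂ E]
    {g : ℤ → E} {x : ℝ} (hg : ∀ k, ‖g k‖ = 1)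
    (hrec : ∀ k, g (k - 1) + g (k + 1) = ((2 * x : ℝ) : ℂ) • g k)
    {α : ℤ → ℝ} {c : ℝ} {M : ℕ} (hα : ∀ k, α (k - 1) + α (k + 1) = 2 * c * α k)
    (hα₀ : α (-1) = 0) (hαM : α M = 0) (hnorm : ∑ k ∈ Finset.range M, α k ^ 2 = 1)
    (hx : x ^ 2 ≤ 1) :
    ∑ k ∈ Finset.range M, ‖(2⁻¹ : ℂ) • ((α (k - 1) : ℂ) • g (k - 1) + (α (k + 1) : ℂ) • g (k + 1)) -
        (x : ℂ) • (α k : ℂ) • g k‖ ^ 2 ≤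
      (1 - c) ^ 2 * x ^ 2 + (1 - c ^ 2) * (1 - x ^ 2) := by
  -- Writing `x g k` as the average of its neighbours leaves a residual in `g (k - 1)` and `g (k +
  -- 1)` alone, with coefficients `(α (k ± 1) - α k) / 2`; their sum and difference come from the
  -- eigenvector equation.
  have hrow : ∀ k : ℤ, ‖(2⁻¹ : ℂ) • ((α (k - 1) : ℂ) • g (k - 1) + (α (k + 1) : ℂ) • g (k + 1)) -
        (x : ℂ) • (α k : ℂ) • g k‖ ^ 2 =
      (1 - c) ^ 2 * x ^ 2 * α k ^ 2 +
        (2⁻¹ * (α (k - 1) ^ 2 + α (k + 1) ^ 2) - c ^ 2 * α k ^ 2) * (1 - x ^ 2) := by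
    intro k
    have h1 : (x : ℂ) • (α k : ℂ) • g k =
        (2⁻¹ : ℂ) • (α k : ℂ) • (g (k - 1) + g (k + 1)) := by
      rw [hrec, smul_smul, smul_smul, smul_smul]
      congr 1
      push_cast
      ring
    have h2 : (2⁻¹ : ℂ) • ((α (k - 1) : ℂ) • g (k - 1) + (α (k + 1) : ℂ) • g (k + 1)) -
        (x : ℂ) • (α k : ℂ) • g k =
        (2⁻¹ : ℂ) • (((α (k - 1) - α k : ℝ) : ℂ) • g (k - 1) +
          ((α (k + 1) - α k : ℝ) : ℂ) • g (k + 1)) := by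
      rw [h1]
      push_cast
      module
    rw [h2, norm_smul, mul_pow, normSq_comb_of_three_term (hg _) (hg _) (hg _) (hrec k)]
    have h3 := hα k
    have h4 : α (k - 1) - α k + (α (k + 1) - α k) = -2 * (1 - c) * α k := by linarith
    have h5 : (α (k - 1) - α k - (α (k + 1) - α k)) ^ 2 =
        2 * (α (k - 1) ^ 2 + α (k + 1) ^ 2) - 4 * c ^ 2 * α k ^ 2 := by
      have : (α (k - 1) + α (k + 1)) ^ 2 = (2 * c * α k) ^ 2 := by rw [h3]
      linear_combination -this
    rw [h4, h5]
    have h6 : ‖(2⁻¹ : ℂ)‖ = 2⁻¹ := by simp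
    rw [h6]
    ring
  -- Since `α` vanishes at `-1` and `M`, a shift of the window only drops an endpoint term. The
  -- average of the two shifted sums is thus at most 1, which yields `1 - c ^ 2`.
  have hdown : ∑ k ∈ Finset.range M, α ((k : ℤ) - 1) ^ 2 ≤ 1 := by
    have h := Finset.sum_range_succ' (fun k : ℕ => α ((k : ℤ) - 1) ^ 2) M
    rw [Finset.sum_range_succ] at h
    simp only [Nat.cast_add, Nat.cast_one, add_sub_cancel_right, hnorm, Nat.cast_zero, zero_sub,
      hα₀] at h
    nlinarith [sq_nonneg (α ((M : ℤ) - 1))]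
  have hup : ∑ k ∈ Finset.range M, α ((k : ℤ) + 1) ^ 2 ≤ 1 := by
    have h := Finset.sum_range_succ' (fun k : ℕ => α (k : ℤ) ^ 2) M
    rw [Finset.sum_range_succ, hnorm, hαM] at h
    simp only [Nat.cast_add, Nat.cast_one, Nat.cast_zero] at h
    nlinarith [sq_nonneg (α 0)]
  simp only [hrow]
  rw [Finset.sum_add_distrib, ← Finset.mul_sum, hnorm, ← Finset.sum_mul, Finset.sum_sub_distrib,
    ← Finset.mul_sum, ← Finset.mul_sum, hnorm, Finset.sum_add_distrib]
  nlinarith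

/-- The weights of the phase estimation window: the top eigenvector of the path on `M` vertices. -/
theorem exists_path_eigenvector {M : ℕ} (hM : 0 < M) :
    ∃ α : ℤ → ℝ, (∀ k, α (k - 1) + α (k + 1) = 2 * Real.cos (Real.pi / (M + 1)) * α k) ∧
      α (-1) = 0 ∧ α M = 0 ∧ ∑ k ∈ Finset.range M, α k ^ 2 = 1 := by
  set h : ℝ := Real.pi / (M + 1) with hh
  have hM' : (1 : ℝ) ≤ M := by exact_mod_cast hM
  let s : ℤ → ℝ := fun k => Real.sin (h * (k + 1))
  set N : ℝ := ∑ k ∈ Finset.range M, s k ^ 2 with hN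
  have hpos : 0 < N := by
    refine Finset.sum_pos' (fun _ _ => sq_nonneg _) ⟨0, Finset.mem_range.2 hM, ?_⟩
    refine pow_pos ?_ 2
    simp only [s]
    refine Real.sin_pos_of_pos_of_lt_pi (by simp only [Nat.cast_zero, Int.cast_zero]; positivity) ?_
    simp only [Nat.cast_zero, Int.cast_zero, zero_add, mul_one]
    rw [hh, div_lt_iff₀ (by positivity)]
    nlinarith [Real.pi_pos]
  refine ⟨fun k => s k / √N, fun k => ?_, ?_, ?_, ?_⟩
  · have : s (k - 1) + s (k + 1) = 2 * Real.cos h * s k := by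
      simp only [s]
      push_cast
      rw [show h * ((k : ℝ) - 1 + 1) = h * (k + 1) - h by ring,
        show h * ((k : ℝ) + 1 + 1) = h * (k + 1) + h by ring, Real.sin_sub, Real.sin_add]
      ring
    simp only [← add_div, this, mul_div_assoc]
  · simp [s]
  · have : h * ((M : ℝ) + 1) = Real.pi := by rw [hh]; field_simp
    simp [s, this]
  · simp only [div_pow, Real.sq_sqrt hpos.le]
    rw [← Finset.sum_div, ← hN, div_self hpos.ne']

/-- Half the adjacency matrix of the path on `M` vertices. -/
noncomputable def pathMatrix (M : ℕ) : Matrix (Fin M) (Fin M) ℂ :=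
  Matrix.of fun k l => if (k : ℕ) + 1 = l ∨ (l : ℕ) + 1 = k then 2⁻¹ else 0

theorem isHermitian_pathMatrix (M : ℕ) : (pathMatrix M).IsHermitian := by
  ext k l
  simp only [pathMatrix, Matrix.conjTranspose_apply, Matrix.of_apply, or_comm]
  split_ifs <;> simp

/-- The zero boundary values stand in for the missing neighbours of the two endpoints, so all rows
have the same form. -/
theorem pathMatrix_mulVec {M : ℕ} (v : ℤ → ℂ) (h₀ : v (-1) = 0) (hM : v M = 0) (k : Fin M) :
    (pathMatrix M).mulVec (fun l : Fin M => v (l : ℕ)) k =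
      2⁻¹ * (v ((k : ℕ) - 1) + v ((k : ℕ) + 1)) := by
  simp only [Matrix.mulVec, dotProduct, pathMatrix, Matrix.of_apply]
  have hsplit : ∀ l : Fin M,
      (if (k : ℕ) + 1 = l ∨ (l : ℕ) + 1 = k then (2⁻¹ : ℂ) else 0) * v (l : ℕ) =
        (if (k : ℕ) + 1 = l then 2⁻¹ * v (l : ℕ) else 0) +
          if (l : ℕ) + 1 = k then 2⁻¹ * v (l : ℕ) else 0 := by
    intro l
    by_cases h1 : (k : ℕ) + 1 = l
    · have h2 : ¬ (l : ℕ) + 1 = k := by omega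
      simp [h1, h2]
    · simp [h1]
  simp only [hsplit]
  rw [Finset.sum_add_distrib, mul_add, add_comm]
  congr 1
  · rw [Fin.sum_univ_eq_sum_range (fun l => if l + 1 = (k : ℕ) then (2⁻¹ : ℂ) * v (l : ℤ) else 0) M]
    rcases Nat.eq_zero_or_pos (k : ℕ) with hk | hk
    · simp [hk, h₀]
    · rw [Finset.sum_eq_single ((k : ℕ) - 1)]
      · rw [if_pos (by omega), Nat.cast_sub hk, Nat.cast_one]
      · intro b _ hb
        rw [if_neg (by omega)]
      · intro hk'
        exact absurd (Finset.mem_range.2 (by omega)) hk'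
  · rw [Fin.sum_univ_eq_sum_range (fun l => if (k : ℕ) + 1 = l then (2⁻¹ : ℂ) * v (l : ℤ) else 0) M]
    rw [Finset.sum_ite_eq]
    split_ifs with hk
    · push_cast
      rfl
    · have : (k : ℕ) + 1 = M := by
        have := Finset.mem_range.not.1 hk
        omega
      have h2 : ((k : ℕ) : ℤ) + 1 = M := by exact_mod_cast this
      rw [h2, hM, mul_zero]

open Matrix in
theorem sum_normSq_mulVec {ι : Type*} [Fintype ι] [DecidableEq ι] (U : unitaryGroup ι ℂ)
    (v : ι → ℂ) : ∑ i, ‖(U : Matrix ι ι ℂ).mulVec v i‖ ^ 2 = ∑ i, ‖v i‖ ^ 2 := by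
  have h : ∀ w : ι → ℂ, ((∑ i, ‖w i‖ ^ 2 : ℝ) : ℂ) = star w ⬝ᵥ w := by
    intro w
    rw [dotProduct]
    push_cast
    refine Finset.sum_congr rfl fun i _ => ?_
    rw [Pi.star_apply, ← Complex.conj_mul']
    rfl
  have h2 : ((∑ i, ‖(U : Matrix ι ι ℂ).mulVec v i‖ ^ 2 : ℝ) : ℂ) =
      ((∑ i, ‖v i‖ ^ 2 : ℝ) : ℂ) := by
    rw [h, h, star_mulVec, ← dotProduct_mulVec, mulVec_mulVec, ← star_eq_conjTranspose,
      Unitary.star_mul_self_of_mem U.2, one_mulVec]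
  exact_mod_cast h2

open Matrix in
/-- The second moment of a measurement in an eigenbasis. -/
theorem Matrix.IsHermitian.sum_normSq_mul_eigenvalues_sub {ι : Type*} [Fintype ι] [DecidableEq ι]
    {C : Matrix ι ι ℂ} (hC : C.IsHermitian) (v : ι → ℂ) (x : ℝ) :
    ∑ j, ‖((hC.eigenvectorUnitary⁻¹ : unitaryGroup ι ℂ) : Matrix ι ι ℂ).mulVec v j‖ ^ 2 *
        (hC.eigenvalues j - x) ^ 2 =
      ∑ i, ‖C.mulVec v i - x * v i‖ ^ 2 := by
  set E := hC.eigenvectorUnitary with hE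
  have h1 : ((E⁻¹ : unitaryGroup ι ℂ) : Matrix ι ι ℂ) * C =
      diagonal (RCLike.ofReal ∘ hC.eigenvalues) * ((E⁻¹ : unitaryGroup ι ℂ) : Matrix ι ι ℂ) := by
    conv_lhs => rw [hC.spectral_theorem]
    rw [Unitary.conjStarAlgAut_apply, UnitaryGroup.inv_val, ← hE, Matrix.mul_assoc,
      ← Matrix.mul_assoc (star _), Unitary.star_mul_self_of_mem E.2, Matrix.one_mul]
  rw [← sum_normSq_mulVec E⁻¹ fun i => C.mulVec v i - x * v i]
  refine Finset.sum_congr rfl fun j _ => ?_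
  have h2 : ((E⁻¹ : unitaryGroup ι ℂ) : Matrix ι ι ℂ).mulVec
      (fun i => C.mulVec v i - x * v i) j =
      ((hC.eigenvalues j - x : ℝ) : ℂ) *
        ((E⁻¹ : unitaryGroup ι ℂ) : Matrix ι ι ℂ).mulVec v j := by
    have h3 : (fun i => C.mulVec v i - x * v i) = C.mulVec v - (x : ℂ) • v := rfl
    rw [h3, mulVec_sub, mulVec_mulVec, h1, mulVec_smul, ← mulVec_mulVec, Pi.sub_apply,
      mulVec_diagonal, Pi.smul_apply]
    simp
    ring
  rw [h2, norm_mul, mul_pow, Complex.norm_real, Real.norm_eq_abs, sq_abs, mul_comm]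

section

open Matrix Matrix.unitaryGroup

variable {ι : Type*} [Fintype ι] [DecidableEq ι]

/-- The Grover iterate of the preparation `A |j⟩` with marked outcomes `s`. -/
def groverIterate (A : unitaryGroup ι ℂ) (s : ι → Bool) (j : ι) : unitaryGroup ι ℂ :=
  phaseOracle some (fun i => decide (i ≠ j)) * (A⁻¹ * phaseOracle some s * A)

theorem groverIterate_inv (A : unitaryGroup ι ℂ) (s : ι → Bool) (j : ι) :
    (groverIterate A s j)⁻¹ =
      (A⁻¹ * phaseOracle some s * A) * phaseOracle some (fun i => decide (i ≠ j)) := by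
  simp [groverIterate, phaseOracle_inv, mul_assoc]

/-- Write `G = R K` with `R` the reflection fixing `|j⟩` and negating the other basis vectors, and
`K` the conjugated phase. Both are involutions, so `(G + G⁻¹)|j⟩ = (R + 1) K |j⟩ = 2 ⟨j|K|j⟩ |j⟩`,
and `⟨j|K|j⟩` is 1 minus twice the marked probability. -/
theorem groverIterate_add_inv_apply (A : unitaryGroup ι ℂ) (s : ι → Bool) (i j : ι) :
    (groverIterate A s j : Matrix ι ι ℂ) i j +
        (((groverIterate A s j)⁻¹ : unitaryGroup ι ℂ) : Matrix ι ι ℂ) i j =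
      if i = j then
        ((2 * (1 - 2 * ∑ l, if s l then ‖(A : Matrix ι ι ℂ) l j‖ ^ 2 else 0) : ℝ) : ℂ) else 0 := by
  rw [groverIterate_inv, groverIterate, UnitaryGroup.mul_val _ (A⁻¹ * phaseOracle some s * A),
    UnitaryGroup.mul_val (A⁻¹ * phaseOracle some s * A)]
  simp only [coe_phaseOracle (ι := ι) _ fun i => decide (i ≠ j), diagonal_mul, mul_diagonal,
    Option.elim_some]
  by_cases hij : i = j
  · subst hij
    have h3 : ((A⁻¹ * phaseOracle some s * A : unitaryGroup ι ℂ) : Matrix ι ι ℂ) i i =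
        ((1 - 2 * ∑ l, if s l then ‖(A : Matrix ι ι ℂ) l i‖ ^ 2 else 0 : ℝ) : ℂ) := by
      rw [UnitaryGroup.mul_val, UnitaryGroup.mul_val, mul_apply, coe_phaseOracle]
      simp only [mul_diagonal, Option.elim_some, UnitaryGroup.inv_val, star_apply]
      rw [← sum_normSq_col A i, Finset.mul_sum, ← Finset.sum_sub_distrib, Complex.ofReal_sum]
      refine Finset.sum_congr rfl fun l _ => ?_
      split_ifs with hs <;>
      · push_cast
        rw [← Complex.conj_mul']
        simp only [RCLike.star_def]
        ring
    rw [h3]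
    simp only [ne_eq, not_true_eq_false, decide_false, Bool.false_eq_true, if_false, if_true]
    push_cast
    ring
  · simp [hij]

variable {M : ℕ}

/-- Phase estimation: the powers of `G` are applied in superposition and the counter is measured in
the eigenbasis `E`. -/
def phaseEstimator (P E : unitaryGroup (Fin M) ℂ) (G : unitaryGroup ι ℂ) :
    unitaryGroup (Fin M × ι) ℂ :=
  onFst ι E⁻¹ * (control (fun k : Fin M => G ^ (k : ℕ)) * onFst ι P)

theorem phaseEstimator_apply (P E : unitaryGroup (Fin M) ℂ) (G : unitaryGroup ι ℂ)
    (k k₀ : Fin M) (i j : ι) :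
    (phaseEstimator P E G : Matrix (Fin M × ι) (Fin M × ι) ℂ) (k, i) (k₀, j) =
      ((E⁻¹ : unitaryGroup (Fin M) ℂ) : Matrix (Fin M) (Fin M) ℂ).mulVec
        (fun l => (P : Matrix (Fin M) (Fin M) ℂ) l k₀ *
          ((G ^ (l : ℕ) : unitaryGroup ι ℂ) : Matrix ι ι ℂ) i j) k := by
  have h : ∀ l i, ((control (fun k : Fin M => G ^ (k : ℕ)) * onFst ι P :
      unitaryGroup (Fin M × ι) ℂ) : Matrix (Fin M × ι) (Fin M × ι) ℂ) (l, i) (k₀, j) =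
        (P : Matrix (Fin M) (Fin M) ℂ) l k₀ *
          ((G ^ (l : ℕ) : unitaryGroup ι ℂ) : Matrix ι ι ℂ) i j := by
    intro l i
    rw [UnitaryGroup.mul_val, mul_apply, Finset.sum_eq_single (l, j)]
    · rw [control_apply, onFst_apply, if_pos rfl, if_pos rfl, mul_comm]
    · rintro ⟨l', j'⟩ - hne
      rw [control_apply, onFst_apply]
      by_cases h1 : l = l'
      · subst h1
        have : j' ≠ j := fun h => hne (by rw [h])
        simp [this]
      · simp [h1]
    · simp
  rw [phaseEstimator, UnitaryGroup.mul_val, mul_apply, Fintype.sum_prod_type]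
  simp only [h, onFst_apply, mulVec, dotProduct, ite_mul, zero_mul, Finset.sum_ite_eq,
    Finset.mem_univ, if_true]

/-- Applying powers of `G` to `hG` makes the vectors `G ^ k |j⟩` satisfy the three-term recurrence.
For each workspace label the spectral second moment is a residual of the path matrix; summing over
labels gives `sum_normSq_three_term_le`. -/
theorem phaseEstimator_second_moment {G : unitaryGroup ι ℂ} {j : ι} {x : ℝ}
    (hG : ∀ i, (G : Matrix ι ι ℂ) i j + ((G⁻¹ : unitaryGroup ι ℂ) : Matrix ι ι ℂ) i j =
      if i = j then ((2 * x : ℝ) : ℂ) else 0) (hx : x ^ 2 ≤ 1)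
    {α : ℤ → ℝ} {c : ℝ} (hα : ∀ k, α (k - 1) + α (k + 1) = 2 * c * α k)
    (hα₀ : α (-1) = 0) (hαM : α M = 0) (hnorm : ∑ k ∈ Finset.range M, α k ^ 2 = 1)
    {P : unitaryGroup (Fin M) ℂ} {k₀ : Fin M}
    (hP : ∀ k : Fin M, (P : Matrix (Fin M) (Fin M) ℂ) k k₀ = α (k : ℕ)) :
    ∑ p : Fin M × ι, ‖(phaseEstimator P (isHermitian_pathMatrix M).eigenvectorUnitary G :
        Matrix (Fin M × ι) (Fin M × ι) ℂ) p (k₀, j)‖ ^ 2 *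
          ((isHermitian_pathMatrix M).eigenvalues p.1 - x) ^ 2 ≤
      (1 - c) ^ 2 * x ^ 2 + (1 - c ^ 2) * (1 - x ^ 2) := by
  -- Integer exponents make the recurrence available at `k = 0` as well.
  let g : ℤ → EuclideanSpace ℂ ι := fun k =>
    WithLp.toLp 2 fun i => ((G ^ k : unitaryGroup ι ℂ) : Matrix ι ι ℂ) i j
  have hg : ∀ k, ‖g k‖ = 1 := fun k => by
    rw [EuclideanSpace.norm_eq, Real.sqrt_eq_one]
    exact sum_normSq_col (G ^ k) j
  have hrec : ∀ k, g (k - 1) + g (k + 1) = ((2 * x : ℝ) : ℂ) • g k := by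
    intro k
    ext i
    simp only [g, PiLp.add_apply, PiLp.smul_apply, _root_.zpow_sub_one, _root_.zpow_add_one,
      UnitaryGroup.mul_val, mul_apply]
    rw [← Finset.sum_add_distrib]
    simp only [← mul_add]
    rw [Finset.sum_congr rfl fun l _ => by rw [add_comm, hG l]]
    simp [mul_comm]
  rw [Fintype.sum_prod_type_right]
  simp only [phaseEstimator_apply, hP]
  rw [Finset.sum_congr rfl fun i _ =>
    (isHermitian_pathMatrix M).sum_normSq_mul_eigenvalues_sub _ x, Finset.sum_comm]
  refine le_trans (le_of_eq ?_) (sum_normSq_three_term_le hg hrec hα hα₀ hαM hnorm hx)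
  rw [← Fin.sum_univ_eq_sum_range (fun k : ℕ => ‖(2⁻¹ : ℂ) • ((α ((k : ℤ) - 1) : ℂ) •
    g ((k : ℤ) - 1) + (α ((k : ℤ) + 1) : ℂ) • g ((k : ℤ) + 1)) - (x : ℂ) • (α k : ℂ) • g k‖ ^ 2) M]
  refine Finset.sum_congr rfl fun k _ => ?_
  rw [EuclideanSpace.norm_sq_eq]
  refine Finset.sum_congr rfl fun i _ => ?_
  have h := pathMatrix_mulVec (M := M) (fun k : ℤ => (α k : ℂ) * g k i) (by simp [hα₀])
    (by simp [hαM]) k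
  simp only [g, zpow_natCast] at h
  rw [h]
  simp [g, mul_add]

/-- Chebyshev's inequality for the measured eigenvalue, which estimates `1 - 2 p`: an outcome on the
wrong side of `θ` is off by at least `w`. The factor `p` kept in the variance bound is what gives
the quadratic speed-up in `exists_detection`. -/
theorem QuerySamplable.exists_amplitude_estimation {X : Type} {T : ℕ} {μ : (X → Bool) → PMF Bool}
    (hμ : QuerySamplable T μ) {M : ℕ} (hM : 0 < M) (θ : ℝ) :
    ∃ ν : (X → Bool) → PMF Bool, QuerySamplable (M * (2 * T)) ν ∧ ∀ f, ∀ w, 0 < w →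
      (1 - 2 * (μ f true).toReal ≤ θ - w → (ν f false).toReal ≤
        ((Real.pi / (M + 1)) ^ 4 + 4 * (Real.pi / (M + 1)) ^ 2 * (μ f true).toReal) / w ^ 2) ∧
      (θ + w ≤ 1 - 2 * (μ f true).toReal → (ν f true).toReal ≤
        ((Real.pi / (M + 1)) ^ 4 + 4 * (Real.pi / (M + 1)) ^ 2 * (μ f true).toReal) / w ^ 2) := by
  obtain ⟨ι, _, _, j, A, out, hA, hμ⟩ := hμ
  obtain ⟨α, hα, hα₀, hαM, hnorm⟩ := exists_path_eigenvector hM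
  let k₀ : Fin M := ⟨0, hM⟩
  obtain ⟨P, hP⟩ := exists_unitary_col k₀ (fun k : Fin M => (α (k : ℕ) : ℂ)) (by
    rw [← hnorm, ← Fin.sum_univ_eq_sum_range (fun k : ℕ => α k ^ 2) M]
    simp)
  set ev := (isHermitian_pathMatrix M).eigenvalues with hev
  let W : (X → Bool) → unitaryGroup (Fin M × ι) ℂ := fun f =>
    phaseEstimator P (isHermitian_pathMatrix M).eigenvectorUnitary (groverIterate (A f) out j)
  have hG : IsQueryFamily (2 * T) fun f => groverIterate (A f) out j :=
    ((hA.inv.mul (.const (phaseOracle some out))).mul hA |>.const_mul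
      (phaseOracle some fun i => decide (i ≠ j))).congr (fun _ => rfl) (by omega)
  have hW : IsQueryFamily (M * (2 * T)) W := by
    refine ((IsQueryFamily.control fun k : Fin M => (hG.pow k).mono
      (Nat.mul_le_mul_right _ k.2.le)).mul (.const (onFst ι P))).const_mul _
  refine ⟨fun f => (bornPMF (W f) (k₀, j)).map fun p => decide (ev p.1 < θ),
    ⟨_, inferInstance, inferInstance, (k₀, j), W, _, hW, fun f => rfl⟩, fun f w hw => ?_⟩
  set p : ℝ := (μ f true).toReal with hp
  have hp0 : 0 ≤ p := ENNReal.toReal_nonneg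
  have hp1 : p ≤ 1 := (μ f).toReal_apply_le_one true
  have hpsum : ∑ l, (if out l then ‖(A f : Matrix ι ι ℂ) l j‖ ^ 2 else 0) = p := by
    rw [hp, hμ, PMF.map_apply, tsum_fintype, ENNReal.toReal_sum]
    · refine Finset.sum_congr rfl fun l _ => ?_
      cases out l <;> simp [bornPMF_apply]
    · intro l _
      split_ifs
      · exact PMF.apply_ne_top _ _
      · simp
  have hmoment := phaseEstimator_second_moment (G := groverIterate (A f) out j) (x := 1 - 2 * p)
    (fun i => by rw [groverIterate_add_inv_apply, hpsum]) (by nlinarith) hα hα₀ hαM hnorm hP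
  set h : ℝ := Real.pi / (M + 1)
  have hcos : 1 - Real.cos h ≤ h ^ 2 / 2 := by linarith [Real.one_sub_sq_div_two_le_cos (x := h)]
  have hcos1 := Real.cos_le_one h
  have hcos2 := Real.neg_one_le_cos h
  have hV : (1 - Real.cos h) ^ 2 * (1 - 2 * p) ^ 2 +
      (1 - Real.cos h ^ 2) * (1 - (1 - 2 * p) ^ 2) ≤ h ^ 4 + 4 * h ^ 2 * p := by
    have h1 : (1 - Real.cos h) ^ 2 ≤ (h ^ 2 / 2) ^ 2 :=
      pow_le_pow_left₀ (by linarith) hcos 2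
    have h2 : (1 - 2 * p) ^ 2 ≤ 1 := by nlinarith
    have h3 : 1 - Real.cos h ^ 2 ≤ h ^ 2 := by nlinarith
    have h4 : 0 ≤ 1 - (1 - 2 * p) ^ 2 := by linarith
    have h5 : 1 - (1 - 2 * p) ^ 2 ≤ 4 * p := by nlinarith
    have h6 : (1 - Real.cos h) ^ 2 * (1 - 2 * p) ^ 2 ≤ (h ^ 2 / 2) ^ 2 * 1 :=
      mul_le_mul h1 h2 (sq_nonneg _) (sq_nonneg _)
    have h7 : (1 - Real.cos h ^ 2) * (1 - (1 - 2 * p) ^ 2) ≤ h ^ 2 * (4 * p) :=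
      mul_le_mul h3 h5 h4 (sq_nonneg _)
    nlinarith [sq_nonneg (h ^ 2)]
  have key : ∀ b : Bool, (∀ l, decide (l < θ) = b → w ^ 2 ≤ (l - (1 - 2 * p)) ^ 2) →
      ((bornPMF (W f) (k₀, j)).map (fun p => decide (ev p.1 < θ)) b).toReal ≤
        (h ^ 4 + 4 * h ^ 2 * p) / w ^ 2 := by
    intro b hb
    rw [le_div_iff₀ (by positivity), PMF.map_apply, tsum_fintype, ENNReal.toReal_sum,
      Finset.sum_mul]
    · refine le_trans (Finset.sum_le_sum fun q _ => ?_) (hmoment.trans hV)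
      split_ifs with hq
      · rw [bornPMF_apply, ENNReal.toReal_ofReal (by positivity)]
        exact mul_le_mul_of_nonneg_left (hb _ hq.symm) (by positivity)
      · rw [ENNReal.toReal_zero, zero_mul]
        positivity
    · intro l _
      split_ifs
      · exact PMF.apply_ne_top _ _
      · simp
  refine ⟨fun hle => key false fun l hl => ?_, fun hle => key true fun l hl => ?_⟩
  · have := of_decide_eq_false hl
    exact pow_le_pow_left₀ hw.le (by linarith) 2
  · have := of_decide_eq_true hl
    rw [← neg_sq (l - _)]
    exact pow_le_pow_left₀ hw.le (by linarith) 2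

end

/-! ### Threshold tests and binary search -/

namespace QuerySamplable

/-- Amplitude estimation decides a threshold with gap `g`. -/
theorem exists_threshold {X : Type} {T : ℕ} {μ : (X → Bool) → PMF Bool} (hμ : QuerySamplable T μ)
    {M : ℕ} (hM : 0 < M) {g : ℝ} (hg : 0 < g) (hg1 : g ≤ 1) (hMg : Real.pi / (M + 1) ≤ g / 7)
    (τ : ℝ) :
    ∃ ν : (X → Bool) → PMF Bool, QuerySamplable (M * (2 * T)) ν ∧ ∀ f,
      ((μ f true).toReal ≤ τ → (ν f true).toReal ≤ 1 / 8) ∧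
      (τ + g ≤ (μ f true).toReal → (ν f false).toReal ≤ 1 / 8) := by
  -- The midpoint of `1 - 2 τ` and `1 - 2 (τ + g)`, at distance `g` from each.
  obtain ⟨ν, hν, h⟩ := hμ.exists_amplitude_estimation hM (1 - 2 * τ - g)
  have hpos : 0 ≤ Real.pi / (M + 1) := by positivity
  have hV : ∀ f, ((Real.pi / (M + 1)) ^ 4 + 4 * (Real.pi / (M + 1)) ^ 2 * (μ f true).toReal) /
      g ^ 2 ≤ 1 / 8 := by
    intro f
    have hp := (μ f).toReal_apply_le_one true
    have h2 : (Real.pi / (M + 1)) ^ 2 ≤ g ^ 2 / 49 :=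
      (pow_le_pow_left₀ hpos hMg 2).trans_eq (by ring)
    have h4 : (Real.pi / (M + 1)) ^ 4 ≤ g ^ 2 / 2401 :=
      (pow_le_pow_left₀ hpos hMg 4).trans (by
        have hg2 : g ^ 2 ≤ 1 := pow_le_one₀ hg.le hg1
        nlinarith [mul_le_mul_of_nonneg_left hg2 (sq_nonneg g)])
    rw [div_le_iff₀ (by positivity)]
    have h5 : 4 * (Real.pi / (M + 1)) ^ 2 * (μ f true).toReal ≤ 4 * (Real.pi / (M + 1)) ^ 2 * 1 :=
      mul_le_mul_of_nonneg_left hp (by positivity)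
    nlinarith [sq_nonneg g]
  exact ⟨ν, hν, fun f => ⟨fun hp => ((h f g hg).2 (by linarith)).trans (hV f),
    fun hp => ((h f g hg).1 (by linarith)).trans (hV f)⟩⟩

/-- Amplitude estimation detects a probability at least `ρ` with `O(1 / √ρ)` repetitions. -/
theorem exists_detection {X : Type} {T : ℕ} {μ : (X → Bool) → PMF Bool} (hμ : QuerySamplable T μ)
    {M : ℕ} (hM : 0 < M) {ρ : ℝ} (hρ : 0 < ρ) (hMρ : (Real.pi / (M + 1)) ^ 2 ≤ ρ / 36) :
    ∃ ν : (X → Bool) → PMF Bool, QuerySamplable (M * (2 * T)) ν ∧ ∀ f,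
      ((μ f true).toReal ≤ ρ / 4 → (ν f true).toReal ≤ 1 / 8) ∧
      (ρ ≤ (μ f true).toReal → (ν f false).toReal ≤ 1 / 8) := by
  obtain ⟨ν, hν, h⟩ := hμ.exists_amplitude_estimation hM (1 - ρ)
  refine ⟨ν, hν, fun f => ?_⟩
  have h4 : (Real.pi / (M + 1)) ^ 4 ≤ ρ ^ 2 / 1296 :=
    calc (Real.pi / (M + 1)) ^ 4 = ((Real.pi / (M + 1)) ^ 2) ^ 2 := by ring
      _ ≤ (ρ / 36) ^ 2 := pow_le_pow_left₀ (sq_nonneg _) hMρ 2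
      _ = _ := by ring
  set p := (μ f true).toReal
  have hp0 : 0 ≤ p := ENNReal.toReal_nonneg
  have h5 : 4 * (Real.pi / (M + 1)) ^ 2 * p ≤ 4 * (ρ / 36) * p := by gcongr
  constructor
  · intro hp
    refine ((h f (ρ / 2) (by positivity)).2 (by linarith)).trans ?_
    rw [div_le_iff₀ (by positivity)]
    nlinarith
  · intro hp
    -- The margin is taken to be `p` itself: it grows with `p` and so controls the variance term `4
    -- h² p` for all `p ≥ ρ`.
    refine ((h f p (by linarith)).1 (by linarith)).trans ?_
    rw [div_le_iff₀ (pow_pos (by linarith) 2)]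
    nlinarith

end QuerySamplable

theorem walshMaxSq_le_iff {n : ℕ} (f : (Fin n → Bool) → Bool) (τ : ℝ) :
    walshMaxSq f ≤ τ ↔ ∀ a, walshCoeff f a ^ 2 ≤ τ := by
  simp [walshMaxSq, Finset.sup'_le_iff]

theorem exists_walshCoeff_sq_eq_walshMaxSq {n : ℕ} (f : (Fin n → Bool) → Bool) :
    ∃ a, walshMaxSq f = walshCoeff f a ^ 2 := by
  obtain ⟨a, -, ha⟩ := Finset.exists_mem_eq_sup' Finset.univ_nonempty
    fun a : Fin n → Bool => walshCoeff f a ^ 2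
  exact ⟨a, ha⟩

theorem walshMaxSq_nonneg {n : ℕ} (f : (Fin n → Bool) → Bool) : 0 ≤ walshMaxSq f := by
  obtain ⟨a, ha⟩ := exists_walshCoeff_sq_eq_walshMaxSq f
  rw [ha]
  exact sq_nonneg _

theorem walshMaxSq_le_one {n : ℕ} (f : (Fin n → Bool) → Bool) : walshMaxSq f ≤ 1 := by
  refine (walshMaxSq_le_iff f 1).2 fun a => ?_
  rw [sq_le_one_iff_abs_le_one]
  exact abs_walshCoeff_le_one f a

/-- A quantum test that distinguishes `walshMaxSq f ≤ τ` from `τ + g ≤ walshMaxSq f`. -/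
theorem exists_walshMaxSq_test (n : ℕ) {g : ℝ} (hg : 0 < g) (hg1 : g ≤ 1) {M₁ M₂ m₁ : ℕ}
    (hM₁ : 0 < M₁) (hM₁g : Real.pi / (M₁ + 1) ≤ g / 7) (hm₁ : (11 / 16 : ℝ) ^ m₁ ≤ g / 8)
    (hM₂ : 0 < M₂) (hM₂g : (Real.pi / (M₂ + 1)) ^ 2 ≤ g / 72) (m₂ : ℕ) {τ : ℝ} (hτ : 0 ≤ τ) :
    ∃ ν : ((Fin n → Bool) → Bool) → PMF Bool,
      QuerySamplable (m₂ * (M₂ * (2 * (1 + m₁ * (M₁ * 2))))) ν ∧ ∀ f,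
        (walshMaxSq f ≤ τ → (ν f true).toReal ≤ (11 / 16) ^ m₂) ∧
        (τ + g ≤ walshMaxSq f → (ν f false).toReal ≤ (11 / 16) ^ m₂) := by
  classical
  obtain ⟨μ, hμ, hμa⟩ := exists_walsh_sampler n
  have hμr : ∀ f a, (μ f a).toReal = walshCoeff f a ^ 2 := fun f a => by
    rw [hμa, ENNReal.toReal_ofReal (sq_nonneg _)]
  have hind : ∀ f a, ((μ f).map (fun b => decide (b = a)) true).toReal = walshCoeff f a ^ 2 := by
    intro f a
    rw [PMF.map_apply, tsum_eq_single a fun b hb => by simp [hb]]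
    simp [hμr]
  choose ν hν hνf using fun a : Fin n → Bool =>
    (hμ.map fun b => decide (b = a)).exists_threshold hM₁ hg hg1 hM₁g τ
  simp only [hind] at hνf
  have hvote : QuerySamplable (1 + m₁ * (M₁ * 2))
      fun f => (μ f).bind fun a => (ν a f).majority m₁ :=
    hμ.bind fun a => (hν a).majority m₁
  obtain ⟨σ, hσ, hσf⟩ := hvote.exists_detection hM₂ (ρ := g / 2) (by positivity) (by linarith)
  refine ⟨_, hσ.majority m₂, fun f => ⟨fun hle => ?_, fun hle => ?_⟩⟩
  · refine PMF.majority_le _ _ _ ((hσf f).1 ?_)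
    rw [PMF.toReal_bind_apply]
    -- Every `a` is accepted with probability at most `g / 8`, and the weights sum to 1.
    calc ∑ a, (μ f a).toReal * ((ν a f).majority m₁ true).toReal
        ≤ ∑ a, (μ f a).toReal * (g / 8) := by
          refine Finset.sum_le_sum fun a _ => mul_le_mul_of_nonneg_left ?_ ENNReal.toReal_nonneg
          exact (PMF.majority_le _ _ _ ((hνf a f).1 ((walshMaxSq_le_iff f τ).1 hle a))).trans hm₁
      _ = g / 2 / 4 := by
          rw [← Finset.sum_mul, PMF.sum_toReal]
          ring
  · refine PMF.majority_le _ _ _ ((hσf f).2 ?_)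
    obtain ⟨a, ha⟩ := exists_walshCoeff_sq_eq_walshMaxSq f
    rw [ha] at hle
    rw [PMF.toReal_bind_apply]
    -- The maximiser alone contributes at least `g (1 - g / 8) ≥ g / 2`; coefficients inside the gap
    -- can only help.
    refine le_trans ?_ (Finset.single_le_sum
      (fun b _ => mul_nonneg ENNReal.toReal_nonneg ENNReal.toReal_nonneg) (Finset.mem_univ a))
    have h1 := (PMF.majority_le _ _ _ ((hνf a f).2 hle)).trans hm₁
    have h2 := ((ν a f).majority m₁).toReal_add_toReal_bool
    rw [hμr]
    nlinarith

theorem PMF.toReal_toOuterMeasure_bind {α β : Type*} [Fintype α] (p : PMF α) (q : α → PMF β)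
    (S : Set β) : ((p.bind q).toOuterMeasure S).toReal =
      ∑ a, (p a).toReal * ((q a).toOuterMeasure S).toReal := by
  have hne : ∀ a, (q a).toOuterMeasure S ≠ ∞ := fun a =>
    ne_top_of_le_ne_top ENNReal.one_ne_top
      (((q a).toOuterMeasure.mono (Set.subset_univ S)).trans_eq
        (((q a).toOuterMeasure_apply_eq_one_iff _).2 (Set.subset_univ _)))
  rw [PMF.toOuterMeasure_bind_apply, tsum_fintype, ENNReal.toReal_sum fun a _ =>
    ENNReal.mul_ne_top (p.apply_ne_top _) (hne a)]
  simp only [ENNReal.toReal_mul]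

/-- Noisy binary search. -/
theorem exists_binary_search {X : Type} (v : (X → Bool) → ℝ) {T : ℕ} {g e : ℝ} (hg : 0 < g)
    (he : 0 ≤ e)
    (htest : ∀ τ, 0 ≤ τ → ∃ ν : (X → Bool) → PMF Bool, QuerySamplable T ν ∧ ∀ f,
      (v f ≤ τ → (ν f true).toReal ≤ e) ∧ (τ + g ≤ v f → (ν f false).toReal ≤ e))
    (L : ℕ) (lo : ℝ) (hlo : 0 ≤ lo) :
    ∃ σ : (X → Bool) → PMF (NonemptyInterval ℝ), QuerySamplable (L * T) σ ∧
      (∀ f, ∀ J ∈ (σ f).support, J.length ≤ 2 * g) ∧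
      ∀ f, lo ≤ v f → v f ≤ lo + (g + 2 ^ L * g) →
        1 - L * e ≤ ((σ f).toOuterMeasure {J | v f ∈ J}).toReal := by
  induction L generalizing lo with
  | zero =>
    refine ⟨fun _ => PMF.pure (intervalAround (lo + g) g hg.le),
      (QuerySamplable.pure X _).mono (by simp), ?_, ?_⟩
    · intro f J hJ
      rw [(PMF.mem_support_pure_iff _ _).1 hJ, length_intervalAround]
    · intro f h1 h2
      have : v f ∈ intervalAround (lo + g) g hg.le := mem_intervalAround (by
        rw [abs_sub_le_iff]
        constructor <;> linarith)
      simp [PMF.toOuterMeasure_pure_apply, this]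
  | succ L ih =>
    have hL : 0 ≤ 2 ^ L * g := by positivity
    -- The two candidate ranges overlap in a strip of width `g`, the gap of the test. There the
    -- answer is arbitrary, but either branch remains valid.
    obtain ⟨ν, hν, hνf⟩ := htest (lo + 2 ^ L * g) (by positivity)
    obtain ⟨σ₀, h₀, hlen₀, hσ₀⟩ := ih lo hlo
    obtain ⟨σ₁, h₁, hlen₁, hσ₁⟩ := ih (lo + 2 ^ L * g) (by positivity)
    refine ⟨fun f => (ν f).bind fun b => (if b then σ₁ else σ₀) f,
      (hν.bind (ν := fun b => if b then σ₁ else σ₀) fun b => by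
        cases b
        · exact h₀
        · exact h₁).mono (by rw [Nat.succ_mul, add_comm]), ?_, ?_⟩
    · intro f J hJ
      obtain ⟨b, -, hb⟩ := (PMF.mem_support_bind_iff _ _ _).1 hJ
      cases b
      · exact hlen₀ f J hb
      · exact hlen₁ f J hb
    · intro f hge hle
      rw [PMF.toReal_toOuterMeasure_bind, Fintype.sum_bool]
      simp only [if_true, Bool.false_eq_true, if_false]
      have hsum := (ν f).toReal_add_toReal_bool
      set t := (ν f true).toReal
      set u := (ν f false).toReal
      set s₁ := ((σ₁ f).toOuterMeasure {J | v f ∈ J}).toReal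
      set s₀ := ((σ₀ f).toOuterMeasure {J | v f ∈ J}).toReal
      have ht : 0 ≤ t := ENNReal.toReal_nonneg
      have hu : 0 ≤ u := ENNReal.toReal_nonneg
      have hs₁ : 0 ≤ s₁ := ENNReal.toReal_nonneg
      have hs₀ : 0 ≤ s₀ := ENNReal.toReal_nonneg
      have hLe : 0 ≤ (L : ℝ) * e := by positivity
      have h2 : (2 : ℝ) ^ (L + 1) * g = 2 * (2 ^ L * g) := by ring
      push_cast
      rcases le_total (v f) (lo + 2 ^ L * g) with hlow | hhigh
      · have h3 := hσ₀ f hge (by linarith)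
        have h4 := (hνf f).1 hlow
        nlinarith [mul_nonneg ht hs₁, mul_le_mul_of_nonneg_left h3 hu, mul_nonneg ht hLe]
      · have h3 := hσ₁ f hhigh (by linarith)
        rcases le_total (v f) (lo + 2 ^ L * g + g) with hmid | htop
        · have h4 := hσ₀ f hge (by linarith)
          nlinarith [mul_le_mul_of_nonneg_left h3 ht, mul_le_mul_of_nonneg_left h4 hu]
        · have h4 := (hνf f).2 htop
          nlinarith [mul_nonneg hu hs₀, mul_le_mul_of_nonneg_left h3 ht, mul_nonneg hu hLe]

/-! ### Choice of parameters and conclusion -/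

theorem eleven_sixteenths_pow_le (k : ℕ) : (11 / 16 : ℝ) ^ (2 * k) ≤ 1 / 2 ^ k := by
  rw [pow_mul, ← one_div_pow]
  exact pow_le_pow_left₀ (by norm_num) (by norm_num) k

theorem le_two_pow_ceil {y : ℝ} (hy : 1 ≤ y) : y ≤ 2 ^ ⌈2 * Real.log y⌉₊ := by
  have h0 := Real.log_nonneg hy
  have h1 := Nat.le_ceil (2 * Real.log y)
  have h2 := Real.log_two_gt_d9
  calc y = Real.exp (Real.log y) := (Real.exp_log (by linarith)).symm
    _ ≤ Real.exp (⌈2 * Real.log y⌉₊ * Real.log 2) := by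
        refine Real.exp_le_exp.2 ?_
        nlinarith
    _ = _ := by rw [Real.exp_nat_mul, Real.exp_log two_pos]

theorem exists_quantum_algorithm :
    ∃ (C : ℝ) (k : ℕ), ∀ (n : ℕ) (ε δ : ℝ), 0 < ε → ε ≤ 1 → 0 < δ → δ < 1 →
      ∃ A : QuantumQueryAlgorithm n (NonemptyInterval ℝ),
        (A.queries : ℝ) ≤
          C * (1 / ε ^ (3 / 2 : ℝ)) * Real.log (2 / ε) ^ k * Real.log (2 / δ) ∧
        (∀ i, (A.out i).length ≤ ε) ∧
        ∀ f : (Fin n → Bool) → Bool, 1 - δ ≤ A.prob f {J | walshMaxSq f ∈ J} := by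
  -- The factors bound in turn the rounds, the outer votes, `M₂`, the two uses per Grover step and
  -- the inner test. Rounds, outer votes and inner votes contribute one `log (2/ε)` each.
  refine ⟨4 * 24 * 39 * 2 * 2882, 3, fun n ε δ hε hε1 hδ hδ1 => ?_⟩
  have hπ := Real.pi_lt_d4
  have hlog2 := Real.log_two_gt_d9
  set ℓ := Real.log (2 / ε) with hℓ
  set D := Real.log (2 / δ) with hD
  have hℓ2 : Real.log 2 ≤ ℓ :=
    Real.log_le_log two_pos (by rw [le_div_iff₀ hε]; linarith)
  have hD2 : Real.log 2 ≤ D :=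
    Real.log_le_log two_pos (by rw [le_div_iff₀ hδ]; linarith)
  have hℓ0 : 0 < ℓ := by linarith
  have hD0 : 0 < D := by linarith
  set L := ⌈2 * ℓ⌉₊ with hL
  -- With `2 * K` votes a round errs with probability at most `2 ^ (-K)`; the summand `L` absorbs
  -- the union over the `L` rounds.
  set K := L + ⌈2 * D⌉₊ with hK
  have hpowL : 2 / ε ≤ 2 ^ L := le_two_pow_ceil (by rw [le_div_iff₀ hε]; linarith)
  have hpowD : 2 / δ ≤ 2 ^ ⌈2 * D⌉₊ := le_two_pow_ceil (by rw [le_div_iff₀ hδ]; linarith)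
  have hsqrt : 0 < √ε := Real.sqrt_pos.2 hε
  have hsq : √ε ^ 2 = ε := Real.sq_sqrt hε.le
  have hsqrt1 : √ε ≤ 1 := Real.sqrt_le_one.2 hε1
  -- `44 > 14 π` and `38 > 12 π`, as required by the threshold and detection tests with gap `ε / 2`.
  set M₁ := ⌈44 / ε⌉₊ with hM₁
  set M₂ := ⌈38 / √ε⌉₊ with hM₂
  have hM₁le : 44 / ε ≤ M₁ := Nat.le_ceil _
  have hM₂le : 38 / √ε ≤ M₂ := Nat.le_ceil _
  have hM₁g : Real.pi / (M₁ + 1) ≤ ε / 2 / 7 := by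
    rw [div_le_iff₀ (by positivity)]
    rw [div_le_iff₀ hε] at hM₁le
    nlinarith
  have hM₂g : (Real.pi / (M₂ + 1)) ^ 2 ≤ ε / 2 / 72 := by
    have h : Real.pi / (M₂ + 1) ≤ √ε / 12 := by
      rw [div_le_iff₀ (by positivity)]
      rw [div_le_iff₀ hsqrt] at hM₂le
      nlinarith
    calc (Real.pi / (M₂ + 1)) ^ 2 ≤ (√ε / 12) ^ 2 := pow_le_pow_left₀ (by positivity) h 2
      _ = ε / 2 / 72 := by rw [div_pow, hsq]; ring
  have hm₁ : (11 / 16 : ℝ) ^ (2 * (L + 3)) ≤ ε / 2 / 8 := by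
    refine (eleven_sixteenths_pow_le _).trans ?_
    rw [div_le_iff₀ (by positivity), pow_add]
    rw [div_le_iff₀ hε] at hpowL
    nlinarith
  have herr : L * (11 / 16 : ℝ) ^ (2 * K) ≤ δ := by
    have h1 : (L : ℝ) ≤ 2 ^ L := by exact_mod_cast Nat.lt_two_pow_self.le
    calc L * (11 / 16 : ℝ) ^ (2 * K) ≤ 2 ^ L * (1 / 2 ^ K) :=
          mul_le_mul h1 (eleven_sixteenths_pow_le _) (by positivity) (by positivity)
      _ = 1 / 2 ^ ⌈2 * D⌉₊ := by
          rw [hK, pow_add]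
          field_simp
      _ ≤ δ := by
          rw [div_le_iff₀ (by positivity)]
          rw [div_le_iff₀ hδ] at hpowD
          nlinarith
  obtain ⟨σ, hσ, hlen, hprob⟩ := exists_binary_search (fun f => walshMaxSq f)
    (g := ε / 2) (e := (11 / 16) ^ (2 * K)) (by positivity) (by positivity)
    (fun τ hτ => exists_walshMaxSq_test n (by positivity) (by linarith)
      (Nat.ceil_pos.2 (by positivity)) hM₁g hm₁ (Nat.ceil_pos.2 (by positivity)) hM₂g (2 * K) hτ)
    L 0 le_rfl
  obtain ⟨A, hAq, hAout, hA⟩ := hσ.exists_quantumQueryAlgorithm (P := fun J => J.length ≤ ε)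
    (fun f J hJ => (hlen f J hJ).trans_eq (by ring)) (intervalAround 0 0 le_rfl)
    (by rw [length_intervalAround]; linarith)
  refine ⟨A, ?_, hAout, fun f => ?_⟩
  · have hL4 : (L : ℝ) ≤ 4 * ℓ := by
      have := Nat.ceil_lt_add_one (by linarith : 0 ≤ 2 * ℓ)
      linarith
    have hL1 : (1 : ℝ) ≤ L := by linarith [Nat.le_ceil (2 * ℓ)]
    have hK12 : (K : ℝ) ≤ 12 * (ℓ * D) := by
      have := Nat.ceil_lt_add_one (by linarith : 0 ≤ 2 * D)
      rw [hK]
      push_cast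
      nlinarith
    have hM₁u : (M₁ : ℝ) ≤ 45 / ε := by
      have h1 := Nat.ceil_lt_add_one (by positivity : 0 ≤ 44 / ε)
      have h2 : 1 ≤ 1 / ε := by rw [le_div_iff₀ hε]; linarith
      have h3 : 45 / ε = 44 / ε + 1 / ε := by ring
      linarith
    have hM₂u : (M₂ : ℝ) ≤ 39 / √ε := by
      have h1 := Nat.ceil_lt_add_one (by positivity : 0 ≤ 38 / √ε)
      have h2 : 1 ≤ 1 / √ε := by rw [le_div_iff₀ hsqrt]; linarith
      have h3 : 39 / √ε = 38 / √ε + 1 / √ε := by ring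
      linarith
    have hrpow : ε ^ (3 / 2 : ℝ) = ε * √ε := by
      rw [show (3 / 2 : ℝ) = 1 + 1 / 2 by norm_num, Real.rpow_add hε, Real.rpow_one,
        Real.sqrt_eq_rpow]
    have hinner : 1 + 2 * ((L : ℝ) + 3) * (M₁ * 2) ≤ 2882 * (ℓ / ε) := by
      have h1 : 2 * ((L : ℝ) + 3) ≤ 32 * ℓ := by linarith
      have h2 : 1 ≤ 2 * (ℓ / ε) := by
        rw [← mul_div_assoc, le_div_iff₀ hε]
        linarith
      calc 1 + 2 * ((L : ℝ) + 3) * (M₁ * 2) ≤ 2 * (ℓ / ε) + 32 * ℓ * (45 / ε * 2) := by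
            gcongr
        _ = _ := by ring
    rw [hAq, hrpow]
    push_cast
    calc (L : ℝ) * (2 * K * (M₂ * (2 * (1 + 2 * ((L : ℝ) + 3) * (M₁ * 2)))))
        ≤ 4 * ℓ * (2 * (12 * (ℓ * D)) * (39 / √ε * (2 * (2882 * (ℓ / ε))))) := by
          gcongr
      _ = _ := by
          field_simp
          ring
  · rw [hA]
    -- The initial range reaches beyond 1 because `2 ^ L ≥ 2 / ε`.
    have h := hprob f (walshMaxSq_nonneg f) (by
      have := walshMaxSq_le_one f
      rw [div_le_iff₀ hε] at hpowL
      linarith)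
    linarith

theorem theorem2p1 :
    (∃ (C : ℝ) (k : ℕ), ∀ (n : ℕ) (ε δ : ℝ), 0 < ε → ε ≤ 1 → 0 < δ → δ < 1 →
      ∃ A : QuantumQueryAlgorithm n (NonemptyInterval ℝ),
        (A.queries : ℝ) ≤
          C * (1 / ε ^ (3 / 2 : ℝ)) * Real.log (2 / ε) ^ k * Real.log (2 / δ) ∧
        (∀ i, (A.out i).length ≤ ε) ∧
        ∀ f : (Fin n → Bool) → Bool, 1 - δ ≤ A.prob f {J | walshMaxSq f ∈ J}) ∧
    (∃ (C : ℝ) (k : ℕ), ∀ (n : ℕ) (ε δ : ℝ), 0 < ε → ε ≤ 1 → 0 < δ → δ < 1 →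
      ∃ A : RandomizedQueryAlgorithm n (NonemptyInterval ℝ),
        (A.queries : ℝ) ≤
          C * (n / ε ^ 3) * (Real.log (2 / ε) * Real.log (n + 2)) ^ k * Real.log (2 / δ) ∧
        (∀ t ∈ A.tree.support, ∀ f : (Fin n → Bool) → Bool, (t.run f).length ≤ ε) ∧
        ∀ f : (Fin n → Bool) → Bool, 1 - δ ≤ A.prob f {J | walshMaxSq f ∈ J}) :=
  ⟨exists_quantum_algorithm, exists_classical_algorithm⟩
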